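/- Let $d\ge 0$ and $G\in GL_{1+d}(\mathbb R)$, and let $(e_0,\dots,e_d)$ be the canonical basis of $\mathbb R^{1+d}$. Let $\pi:\mathbb R^{1+d}\to\mathbb R^d$ be the projection forgetting the coordinate of index $0$. For $y,\xi\in\mathbb R^d$, $|\xi|<1$, put $$f(\xi)=\sqrt{1-|\xi|^2},\quad \sigma(\xi)=(f(\xi),\xi),\quad g(\xi)=\pi\,{}^tG\,\sigma(\xi),\quad \varphi(y,\xi)=\langle y,g(\xi)\rangle,$$ $$\alpha(y)=\langle y,\pi\,{}^tG\,e_0\rangle,\qquad \tilde x=\tilde x(y,\xi)=-{}^t\mathrm dg(\xi)\,y .$$ Let $\hbar_0>0$ and, for $\hbar\in(0,\hbar_0]$, let $q_\hbar(\xi,\tilde x)=q_0(\xi,\tilde x)+\hbar q_1(\xi,\tilde x)+\hbar^2 r_\hbar(\xi,\tilde x)$, where $q_0,q_1,r_\hbar$ are smooth complex-valued functions on $\mathbb R^d\times\mathbb R^d$ and all derivatives of each of them are bounded by constants times one fixed power of $1+|(\xi,\tilde x)|$ (for $r_\hbar$: with constants and power independent of $\hbar$). Let $Q=\mathrm{Op}^w_\hbar(q_\hbar)$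 be the operator with (oscillatory integral) Schwartz kernel $$K_Q(\eta,\xi)=\int_{\mathbb R^d}e^{\frac i\hbar\langle\eta-\xi,\tilde x\rangle}\,q_\hbar\!\left(\tfrac{\eta+\xi}2,\tilde x\right)d\tilde x .$$ Let $\chi\in C^\infty_c(\mathbb R^d;\mathbb R)$ be a cut-off with support in the open unit ball, let $\Omega$ be the interior of $\{\chi=1\}$, and let $V_G$, localized by $\chi$ to the region $|\eta|<1$, be $$[V_G\chi\, v](y)=\frac1{(2\pi\hbar)^d}\int_{\mathbb R^d}e^{\frac i\hbar\varphi(y,\eta)}\chi(\eta)v(\eta)\,d\eta .$$ Then for every $\hbar\in(0,\hbar_0]$ the operator $V_G\chi Q$, acting on Schwartz functions, has a continuous Schwartz kernel $K_\hbar$ on $\mathbb R^d\times\mathbb R^d$, and for all $y\in\mathbb R^d$, $\xi\in\Omega$, $$K_\hbar(y,\xi)=e^{\frac i\hbar\varphi(y,\xi)}\Big[q_0+\hbar q_1+\frac{i\hbar}2\Big(\langle\partial_{\tilde x},\partial_\xi\rangle q_0+\frac{\alpha\,\Delta_{\tilde x}q_0}{f}+\frac{\alpha}{f^3}\langle\xi,\partial_{\tilde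 x}\rangle^2q_0\Big)+\rho_\hbar(y,\xi)\Big],$$ where $q_0$, $q_1$ and the derivatives of $q_0$ are evaluated at $(\xi,\tilde x(y,\xi))$, $f=f(\xi)$, $\alpha=\alpha(y)$, the partial derivatives $\partial_\xi,\partial_{\tilde x}$ are those of $q_0$ with respect to its first and second argument, and in $\langle\xi,\partial_{\tilde x}\rangle^2$ the vector $\xi$ is a constant. The remainder $\rho_\hbar$ is $O(\hbar^2)$ in the $C^\infty$ topology: it is smooth on $\mathbb R^d\times\Omega$ and each of its derivatives is $O(\hbar^2)$, uniformly on compact subsets of $\mathbb R^d\times\Omega$ and for $\hbar\in(0,\hbar_0]$. -/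

import Mathlib

open MeasureTheory Set
open scoped ContDiff SchwartzMap Laplacian

namespace TiltedFIO

noncomputable section

/-- Euclidean space `ℝ^d`. -/
abbrev Eu (d : ℕ) := EuclideanSpace ℝ (Fin d)

/-- Real invertible matrices of size `1 + d`; the index `0` is the propagation direction. -/
abbrev GLd (d : ℕ) := Matrix.GeneralLinearGroup (Fin (d + 1)) ℝ

variable {d : ℕ}

/-- `f(ξ) = √(1 - |ξ|²)`. -/
def fHeight (ξ : Eu d) : ℝ := Real.sqrt (1 - ‖ξ‖ ^ 2)

/-- The lift `σ(ξ) = (f(ξ), ξ) ∈ ℝ^{1+d}`. -/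
def sigma (ξ : Eu d) : Fin (d + 1) → ℝ := Fin.cons (fHeight ξ) (fun j => ξ j)

/-- The vector `π ᵗG v ∈ ℝ^d`, where `π : ℝ^{1+d} → ℝ^d` forgets the coordinate `0`. -/
def piTransp (G : GLd d) (v : Fin (d + 1) → ℝ) : Eu d :=
  WithLp.toLp 2 (Fin.tail ((G : Matrix (Fin (d + 1)) (Fin (d + 1)) ℝ).transpose.mulVec v))

/-- `g(ξ) = π ᵗG σ(ξ)`. -/
def gMap (G : GLd d) (ξ : Eu d) : Eu d := piTransp G (sigma ξ)

/-- The phase `φ(y, ξ) = ⟨y, π ᵗG σ(ξ)⟩`. -/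
def phase (G : GLd d) (y ξ : Eu d) : ℝ := inner ℝ y (gMap G ξ)

/-- `α(y) = ⟨y, π ᵗG e₀⟩`. -/
def alpha (G : GLd d) (y : Eu d) : ℝ := inner ℝ y (piTransp G (Pi.single 0 1))

/-- `x̃(y, ξ) = - ᵗdg(ξ) y`. -/
def xTilde (G : GLd d) (y ξ : Eu d) : Eu d :=
  -(ContinuousLinearMap.adjoint (fderiv ℝ (gMap G) ξ) y)

/-- `e^{i t / h}`. -/
def osc (h t : ℝ) : ℂ := Complex.exp (Complex.I * (t : ℂ) / (h : ℂ))

/-- Smooth symbols on phase space, all of whose derivatives are bounded by a constant times one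
fixed power of `1 + ‖z‖`. -/
def IsSymbol (a : Eu d × Eu d → ℂ) : Prop :=
  ContDiff ℝ ∞ a ∧ ∃ N : ℕ, ∀ k : ℕ, ∃ C : ℝ, ∀ z, ‖iteratedFDeriv ℝ k a z‖ ≤ C * (1 + ‖z‖) ^ N

/-- A family of symbols that is bounded in the symbol class, uniformly in `h ∈ (0, h₀]`. -/
def IsBoundedSymbolFamily (h₀ : ℝ) (r : ℝ → Eu d × Eu d → ℂ) : Prop :=
  (∀ h ∈ Ioc 0 h₀, ContDiff ℝ ∞ (r h)) ∧
    ∃ N : ℕ, ∀ k : ℕ, ∃ C : ℝ, ∀ h ∈ Ioc 0 h₀, ∀ z,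
      ‖iteratedFDeriv ℝ k (r h) z‖ ≤ C * (1 + ‖z‖) ^ N

/-- `q_h = q₀ + h q₁ + O(h²)` in the symbol class, for `h ∈ (0, h₀]`. -/
def HasSymbolExpansion (h₀ : ℝ) (q : ℝ → Eu d × Eu d → ℂ) (q₀ q₁ : Eu d × Eu d → ℂ) : Prop :=
  IsSymbol q₀ ∧ IsSymbol q₁ ∧ ∃ r : ℝ → Eu d × Eu d → ℂ, IsBoundedSymbolFamily h₀ r ∧
    ∀ h ∈ Ioc 0 h₀, ∀ z, q h z = q₀ z + (h : ℂ) * q₁ z + (h : ℂ) ^ 2 * r h z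

/-- The Weyl operator with symbol `a(ξ, x̃)`, whose kernel is the oscillatory integral
`∫ e^{i⟨η - ξ, x̃⟩ / h} a((η + ξ) / 2, x̃) dx̃` (without the prefactor `(2πh)^{-d}`).
On a Schwartz function `u` both iterated integrals below converge absolutely: the inner one decays
rapidly in `x̃`. -/
def weylOp (h : ℝ) (a : Eu d × Eu d → ℂ) (u : Eu d → ℂ) (η : Eu d) : ℂ :=
  ∫ x : Eu d, ∫ ξ : Eu d, osc h (inner ℝ (η - ξ) x) * a ((2⁻¹ : ℝ) • (η + ξ), x) * u ξ

/-- The propagator `V_G` composed with multiplication by the cut-off `χ`: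
`v ↦ (2πh)^{-d} ∫ e^{i φ(y, η) / h} χ(η) v(η) dη`. -/
def cutV (G : GLd d) (χ : Eu d → ℝ) (h : ℝ) (v : Eu d → ℂ) (y : Eu d) : ℂ :=
  (((2 * Real.pi * h) ^ d)⁻¹ : ℝ) * ∫ η : Eu d, osc h (phase G y η) * (χ η : ℂ) * v η

/-- `K` is the (continuous) Schwartz kernel of the operator `T`. -/
def IsSchwartzKernel (T : (Eu d → ℂ) → Eu d → ℂ) (K : Eu d → Eu d → ℂ) : Prop :=
  Continuous (fun p : Eu d × Eu d => K p.1 p.2) ∧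
    ∀ (u : 𝓢(Eu d, ℂ)) (y : Eu d),
      Integrable (fun ξ => K y ξ * u ξ) ∧ T (fun ξ => u ξ) y = ∫ ξ, K y ξ * u ξ

/-- `ρ_h = O(h^m)` in the `C^∞` topology on the open set `U`: every derivative is `O(h^m)`,
uniformly on compact subsets of `U` and for `h ∈ (0, h₀]`. -/
def IsSmoothBigO (h₀ : ℝ) (m : ℕ) (U : Set (Eu d × Eu d)) (ρ : ℝ → Eu d × Eu d → ℂ) : Prop :=
  (∀ h ∈ Ioc 0 h₀, ContDiffOn ℝ ∞ (ρ h) U) ∧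
    ∀ S ⊆ U, IsCompact S → ∀ k : ℕ, ∃ C : ℝ, ∀ h ∈ Ioc 0 h₀, ∀ z ∈ S,
      ‖iteratedFDeriv ℝ k (ρ h) z‖ ≤ C * h ^ m

/-- `⟨∂_x̃, ∂_ξ⟩ q = ∑ⱼ ∂_{x̃ⱼ} ∂_{ξⱼ} q` at `(ξ, x)`. -/
def mixedDiv (q : Eu d × Eu d → ℂ) (ξ x : Eu d) : ℂ :=
  ∑ j : Fin d, iteratedFDeriv ℝ 2 q (ξ, x)
    ![(0, EuclideanSpace.single j (1 : ℝ)), (EuclideanSpace.single j (1 : ℝ), 0)]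

/-- `Δ_x̃ q` at `(ξ, x)`. -/
def laplX (q : Eu d × Eu d → ℂ) (ξ x : Eu d) : ℂ := (Δ (fun x' : Eu d => q (ξ, x'))) x

/-- `⟨ξ, ∂_x̃⟩² q` at `(ξ, x)`, where `ξ` is not differentiated. -/
def radialSq (q : Eu d × Eu d → ℂ) (ξ x : Eu d) : ℂ :=
  iteratedFDeriv ℝ 2 (fun x' : Eu d => q (ξ, x')) x ![ξ, ξ]

end

end TiltedFIO

open TiltedFIO

namespace TiltedFIO

noncomputable section

/-! ### Calculus of families with polynomial growth in `x`, uniform in `h` -/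

section Tempered

variable {W V E F : Type*} [NormedAddCommGroup W] [NormedSpace ℝ W]
  [NormedAddCommGroup V] [NormedSpace ℝ V] [NormedAddCommGroup E] [NormedSpace ℝ E]
  [NormedAddCommGroup F] [NormedSpace ℝ F]

/-! After pulling out `e^{iφ(y,ξ)/h}`, the kernel is `(2πh)^{-d} ∫∫ e^{iΨ/h} a dη dx` with `Ψ =
φ(y,η) - φ(y,ξ) + ⟨η-ξ, x⟩` and `a = χ(η) q((η+ξ)/2, x)`. Since `∂_η Ψ = x - c(y,η)` with `c = -∂_η
φ`, stationary phase becomes an exact identity. Hadamard's lemma in `x` gives `a = a|_{x=c} + ∑ⱼ (xⱼ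
- cⱼ) bⱼ`. The first term does not depend on `x`, so Fourier inversion evaluates its integral as the
value of `a` at `η = ξ`, `x = c(y,ξ)`. In the others, `xⱼ - cⱼ` is traded for `ih ∂_{ηⱼ}` by parts.
Thus `I(a) = critVal a + ih I(nextAmp a)` (`IsAmplitude.oscInt_eq`).

This identity is applied twice to `q₀`, once to `q₁` and not at all to `r_h`. What is left is `h²`
times an oscillatory integral of the same type. The subprincipal term is `critVal (nextAmp a)`,
computed in `critVal_nextAmp` from `∂_{ηⱼ} c = α (eⱼ/f + ηⱼ η/f³)`.

Uniform bounds need no further analysis. Integration by parts in `η` gives rapid decay in `x`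
(`etaInt_decay`), hence a crude bound `h^{-(d+k)}` for derivatives of order `k`; using the identity
`d + k` times removes the loss (`IsAmplitude.iteratedFDeriv_oscInt_bound`).

Two side issues remain. The phase is smooth only for `|η| < 1`, so it is replaced by a globally
smooth one that agrees with it near the support of `χ` (`exists_smooth_phase`). And the iterated
integrals must be reordered although no joint absolute convergence is available
(`integral_triple_swap`). -/

theorem norm_iteratedFDeriv_comp_clm_le (L : W →L[ℝ] V) {f : V → F} (hf : ContDiff ℝ ∞ f)
    (k : ℕ) (z : W) :
    ‖iteratedFDeriv ℝ k (fun w => f (L w)) z‖ ≤ ‖L‖ ^ k * ‖iteratedFDeriv ℝ k f (L z)‖ := by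
  have h := L.iteratedFDeriv_comp_right hf z (i := k) (by exact_mod_cast le_top)
  change ‖iteratedFDeriv ℝ k (f ∘ L) z‖ ≤ _
  rw [h]
  refine (ContinuousMultilinearMap.norm_compContinuousLinearMap_le _ _).trans ?_
  simp [mul_comm]

/-- Uniform symbol-type bounds over `S` for a family of functions of `(w, x)`. -/
def TempOn (h₀ : ℝ) (S : Set W) (N : ℕ) (a : ℝ → W × E → ℂ) : Prop :=
  ∀ k : ℕ, ∃ C : ℝ, ∀ h ∈ Ioc 0 h₀, ∀ w ∈ S, ∀ x,
    ‖iteratedFDeriv ℝ k (a h) (w, x)‖ ≤ C * (1 + ‖x‖) ^ N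

/-- A family, indexed by `h ∈ (0, h₀]`, of smooth functions of `(w, x)`. -/
def SmoothFam (h₀ : ℝ) (a : ℝ → W × E → ℂ) : Prop :=
  ∀ h ∈ Ioc 0 h₀, ContDiff ℝ ∞ (a h)

/-- Smooth families with symbol-type bounds in `x`, locally uniformly in `w` and uniformly in
`h ∈ (0, h₀]`. -/
structure IsTempered (h₀ : ℝ) (a : ℝ → W × E → ℂ) : Prop where
  smooth : SmoothFam h₀ a
  growth : ∀ S : Set W, IsCompact S → ∃ N, TempOn h₀ S N a

variable {h₀ : ℝ} {S : Set W} {N M : ℕ} {a b : ℝ → W × E → ℂ}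

theorem one_le_one_add_norm {E : Type*} [NormedAddCommGroup E] (x : E) : 1 ≤ 1 + ‖x‖ := by linarith [norm_nonneg x]

theorem TempOn.exists_nonneg (ha : TempOn h₀ S N a) (k : ℕ) :
    ∃ C : ℝ, 0 ≤ C ∧ ∀ h ∈ Ioc 0 h₀, ∀ w ∈ S, ∀ x,
      ‖iteratedFDeriv ℝ k (a h) (w, x)‖ ≤ C * (1 + ‖x‖) ^ N := by
  obtain ⟨C, hC⟩ := ha k
  refine ⟨|C|, abs_nonneg C, fun h hh w hw x => (hC h hh w hw x).trans ?_⟩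
  gcongr
  exact le_abs_self C

theorem TempOn.mono (ha : TempOn h₀ S N a) (hN : N ≤ M) : TempOn h₀ S M a := fun k => by
  obtain ⟨C, hC0, hC⟩ := ha.exists_nonneg k
  refine ⟨C, fun h hh w hw x => (hC h hh w hw x).trans ?_⟩
  gcongr
  exact one_le_one_add_norm x

theorem TempOn.add (ha : TempOn h₀ S N a) (hb : TempOn h₀ S N b)
    (sa : SmoothFam h₀ a) (sb : SmoothFam h₀ b) :
    TempOn h₀ S N (fun h z => a h z + b h z) := fun k => by
  obtain ⟨C, hC⟩ := ha k
  obtain ⟨D, hD⟩ := hb k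
  refine ⟨C + D, fun h hh w hw x => ?_⟩
  have := fun z => iteratedFDeriv_add_apply (x := z) (i := k)
    ((sa h hh).of_le (by exact_mod_cast le_top)).contDiffAt
    ((sb h hh).of_le (by exact_mod_cast le_top)).contDiffAt
  change ‖iteratedFDeriv ℝ k (a h + b h) (w, x)‖ ≤ _
  rw [this, add_mul]
  exact (norm_add_le _ _).trans (add_le_add (hC h hh w hw x) (hD h hh w hw x))

theorem TempOn.mul (ha : TempOn h₀ S N a) (hb : TempOn h₀ S M b)
    (sa : SmoothFam h₀ a) (sb : SmoothFam h₀ b) :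
    TempOn h₀ S (N + M) (fun h z => a h z * b h z) := fun k => by
  choose C hC0 hC using ha.exists_nonneg
  choose D hD0 hD using hb.exists_nonneg
  refine ⟨∑ i ∈ Finset.range (k + 1), (k.choose i : ℝ) * C i * D (k - i),
    fun h hh w hw x => ?_⟩
  refine (norm_iteratedFDeriv_mul_le (sa h hh) (sb h hh) (w, x)
    (n := k) (by exact_mod_cast le_top)).trans ?_
  rw [Finset.sum_mul]
  refine Finset.sum_le_sum fun i _ => ?_
  calc (k.choose i : ℝ) * ‖iteratedFDeriv ℝ i (a h) (w, x)‖
        * ‖iteratedFDeriv ℝ (k - i) (b h) (w, x)‖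
      ≤ (k.choose i : ℝ) * (C i * (1 + ‖x‖) ^ N) * (D (k - i) * (1 + ‖x‖) ^ M) := by
        have := hC0 i
        gcongr
        · exact hC i h hh w hw x
        · exact hD (k - i) h hh w hw x
    _ = _ := by ring

theorem TempOn.fderiv_apply (ha : TempOn h₀ S N a) (sa : SmoothFam h₀ a) (v : W × E) :
    TempOn h₀ S N (fun h z => fderiv ℝ (a h) z v) := fun k => by
  obtain ⟨C, hC⟩ := ha (k + 1)
  refine ⟨‖v‖ * C, fun h hh w hw x => ?_⟩
  have h1 : ContDiff ℝ ∞ (fderiv ℝ (a h)) := (sa h hh).fderiv_right (by simp)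
  refine (norm_iteratedFDeriv_clm_apply_const (n := k) h1.contDiffAt
    (by exact_mod_cast le_top)).trans ?_
  rw [norm_iteratedFDeriv_fderiv, mul_assoc]
  gcongr
  exact hC h hh w hw x

theorem SmoothFam.add (sa : SmoothFam h₀ a) (sb : SmoothFam h₀ b) :
    SmoothFam h₀ (fun h z => a h z + b h z) := fun h hh => (sa h hh).add (sb h hh)

theorem SmoothFam.mul (sa : SmoothFam h₀ a) (sb : SmoothFam h₀ b) :
    SmoothFam h₀ (fun h z => a h z * b h z) := fun h hh => (sa h hh).mul (sb h hh)

theorem SmoothFam.fderiv_apply (sa : SmoothFam h₀ a) (v : W × E) :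
    SmoothFam h₀ (fun h z => fderiv ℝ (a h) z v) := fun h hh =>
  ((sa h hh).fderiv_right (m := ∞) (by simp)).clm_apply contDiff_const

theorem TempOn.const_mul (ha : TempOn h₀ S N a) (sa : SmoothFam h₀ a) {c : ℝ → ℂ} {R : ℝ}
    (hc : ∀ h ∈ Ioc 0 h₀, ‖c h‖ ≤ R) : TempOn h₀ S N (fun h z => c h * a h z) := fun k => by
  obtain ⟨C, hC0, hC⟩ := ha.exists_nonneg k
  refine ⟨R * C, fun h hh w hw x => ?_⟩
  change ‖iteratedFDeriv ℝ k (c h • a h) (w, x)‖ ≤ _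
  rw [iteratedFDeriv_const_smul_apply ((sa h hh).of_le (by exact_mod_cast le_top)).contDiffAt,
    norm_smul, mul_assoc]
  exact mul_le_mul (hc h hh) (hC h hh w hw x) (norm_nonneg _) ((norm_nonneg _).trans (hc h hh))

theorem SmoothFam.const_mul (sa : SmoothFam h₀ a) (c : ℝ → ℂ) :
    SmoothFam h₀ (fun h z => c h * a h z) := fun h hh => contDiff_const.mul (sa h hh)

/-- Only the image of `S` under `L` has to lie in a compact set. This matters for the critical
point, which depends on `(y, η)` but not on `ξ`: estimates stay uniform over unbounded sets of `ξ`.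
-/
theorem TempOn.base {m : V → ℂ} (hm : ContDiff ℝ ∞ m) (L : W →L[ℝ] V) {K : Set V}
    (hK : IsCompact K) (hS : MapsTo L S K) :
    TempOn h₀ S 0 (fun _ (z : W × E) => m (L z.1)) := fun k => by
  obtain ⟨C, hC⟩ := (hK.image_of_continuousOn
    (hm.continuous_iteratedFDeriv (m := k) (by exact_mod_cast le_top)).continuousOn).isBounded.exists_norm_le
  refine ⟨‖L.comp (ContinuousLinearMap.fst ℝ W E)‖ ^ k * C, fun h hh w hw x => ?_⟩
  refine (norm_iteratedFDeriv_comp_clm_le (L.comp (ContinuousLinearMap.fst ℝ W E)) hm k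
    (w, x)).trans ?_
  simp only [pow_zero, mul_one]
  gcongr
  exact hC _ (mem_image_of_mem _ (hS hw))

theorem TempOn.linear (l : E →L[ℝ] ℂ) : TempOn h₀ S 1 (fun _ (z : W × E) => l z.2) := by
  set L := l.comp (ContinuousLinearMap.snd ℝ W E) with hL
  have hd : ∀ z, fderiv ℝ (fun z : W × E => l z.2) z = L := fun z => L.fderiv
  rintro (_ | _ | k)
  · refine ⟨‖l‖, fun h hh w hw x => ?_⟩
    rw [norm_iteratedFDeriv_zero, pow_one]
    refine (l.le_opNorm x).trans ?_
    gcongr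
    linarith
  · refine ⟨‖L‖, fun h hh w hw x => ?_⟩
    rw [← norm_iteratedFDeriv_fderiv, norm_iteratedFDeriv_zero, hd]
    nlinarith [norm_nonneg L, norm_nonneg x]
  · refine ⟨0, fun h hh w hw x => ?_⟩
    rw [← norm_iteratedFDeriv_fderiv, funext hd, iteratedFDeriv_const_of_ne (by omega)]
    simp

namespace IsTempered

theorem add (ha : IsTempered h₀ a) (hb : IsTempered h₀ b) :
    IsTempered h₀ (fun h z => a h z + b h z) where
  smooth := ha.smooth.add hb.smooth
  growth S hS := by
    obtain ⟨N, hN⟩ := ha.growth S hS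
    obtain ⟨M, hM⟩ := hb.growth S hS
    exact ⟨max N M, (hN.mono (le_max_left _ _)).add (hM.mono (le_max_right _ _)) ha.smooth hb.smooth⟩

theorem mul (ha : IsTempered h₀ a) (hb : IsTempered h₀ b) :
    IsTempered h₀ (fun h z => a h z * b h z) where
  smooth := ha.smooth.mul hb.smooth
  growth S hS := by
    obtain ⟨N, hN⟩ := ha.growth S hS
    obtain ⟨M, hM⟩ := hb.growth S hS
    exact ⟨N + M, hN.mul hM ha.smooth hb.smooth⟩

theorem const_mul (ha : IsTempered h₀ a) {c : ℝ → ℂ} {R : ℝ}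
    (hc : ∀ h ∈ Ioc 0 h₀, ‖c h‖ ≤ R) : IsTempered h₀ (fun h z => c h * a h z) where
  smooth := ha.smooth.const_mul c
  growth S hS := by
    obtain ⟨N, hN⟩ := ha.growth S hS
    exact ⟨N, hN.const_mul ha.smooth hc⟩

theorem fderiv_apply (ha : IsTempered h₀ a) (v : W × E) :
    IsTempered h₀ (fun h z => fderiv ℝ (a h) z v) where
  smooth := ha.smooth.fderiv_apply v
  growth S hS := by
    obtain ⟨N, hN⟩ := ha.growth S hS
    exact ⟨N, hN.fderiv_apply ha.smooth v⟩

theorem base {m : W → ℂ} (hm : ContDiff ℝ ∞ m) :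
    IsTempered h₀ (fun _ (z : W × E) => m z.1) where
  smooth _ _ := hm.comp contDiff_fst
  growth _ hS := ⟨0, TempOn.base hm (ContinuousLinearMap.id ℝ W) hS (fun _ h => h)⟩

theorem linear (l : E →L[ℝ] ℂ) : IsTempered h₀ (fun _ (z : W × E) => l z.2) where
  smooth _ _ := l.contDiff.comp contDiff_snd
  growth _ _ := ⟨1, TempOn.linear l⟩

theorem sum {ι : Type*} (s : Finset ι) {f : ι → ℝ → W × E → ℂ}
    (hf : ∀ i, IsTempered h₀ (f i)) : IsTempered h₀ (fun h z => ∑ i ∈ s, f i h z) := by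
  classical
  induction s using Finset.induction_on with
  | empty => simpa using base (h₀ := h₀) (W := W) (E := E) (contDiff_const (c := (0 : ℂ)))
  | insert i s hi ih => simpa [Finset.sum_insert hi] using (hf i).add ih

/-- Pull-back of a bounded family of symbols by a linear map. -/
theorem symbol {d : ℕ} {r : ℝ → Eu d × Eu d → ℂ} (hr : IsBoundedSymbolFamily h₀ r)
    (L : W × E →L[ℝ] Eu d × Eu d) : IsTempered h₀ (fun h z => r h (L z)) where
  smooth h hh := (hr.1 h hh).comp L.contDiff
  growth S hS := by
    obtain ⟨N, hN⟩ := hr.2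
    obtain ⟨R, hR⟩ := hS.isBounded.exists_norm_le
    refine ⟨N, fun k => ?_⟩
    obtain ⟨C, hC⟩ := hN k
    refine ⟨‖L‖ ^ k * (|C| * (1 + ‖L‖ * (|R| + 1)) ^ N), fun h hh w hw x => ?_⟩
    refine (norm_iteratedFDeriv_comp_clm_le L (hr.1 h hh) k _).trans ?_
    have h1 : 1 + ‖L (w, x)‖ ≤ (1 + ‖L‖ * (|R| + 1)) * (1 + ‖x‖) := by
      have h2 : ‖L (w, x)‖ ≤ ‖L‖ * (|R| + ‖x‖) := by
        refine (L.le_opNorm _).trans ?_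
        gcongr
        rw [Prod.norm_mk]
        refine max_le ?_ ?_
        · linarith [hR w hw, le_abs_self R, norm_nonneg x]
        · linarith [abs_nonneg R]
      have h3 := mul_nonneg (norm_nonneg L) (norm_nonneg x)
      have h4 := mul_nonneg (mul_nonneg (norm_nonneg L) (abs_nonneg R)) (norm_nonneg x)
      nlinarith [norm_nonneg L, norm_nonneg x]
    rw [mul_assoc, mul_assoc, ← mul_pow]
    gcongr
    refine (hC h hh _).trans ?_
    gcongr
    exact le_abs_self C

end IsTempered

end Tempered

/-! ### Differentiation under integrals over compact sets -/

section ParametricIntegral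

open Filter Topology

variable {V G : Type*} [NormedAddCommGroup V] [NormedSpace ℝ V]
  [NormedAddCommGroup G] [NormedSpace ℝ G]

theorem hasFDerivAt_setIntegral_of_continuous [ProperSpace V] {α : Type*}
    [TopologicalSpace α] [MeasurableSpace α] [OpensMeasurableSpace α] [T2Space α]
    {μ : Measure α} [IsFiniteMeasureOnCompacts μ] {K : Set α} (hK : IsCompact K)
    {g : α × V → G} {g' : α × V → V →L[ℝ] G} (hg : Continuous g) (hg' : Continuous g')
    (hd : ∀ t x, HasFDerivAt (fun y => g (t, y)) (g' (t, x)) x) (x : V) :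
    HasFDerivAt (fun y => ∫ t in K, g (t, y) ∂μ) (∫ t in K, g' (t, x) ∂μ) x := by
  obtain ⟨C, hC⟩ := ((hK.prod (isCompact_closedBall x 1)).image_of_continuousOn
    hg'.continuousOn).isBounded.exists_norm_le
  have hgi : ∀ y, ContinuousOn (fun t => g (t, y)) K := fun y => by fun_prop
  have hgi' : ∀ y, ContinuousOn (fun t => g' (t, y)) K := fun y => by fun_prop
  refine hasFDerivAt_integral_of_dominated_of_fderiv_le (s := Metric.closedBall x 1)
    (F := fun y t => g (t, y)) (F' := fun y t => g' (t, y)) (bound := fun _ => C)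
    (Metric.closedBall_mem_nhds x one_pos) ?_ ?_ ?_ ?_ ?_ ?_
  · exact Eventually.of_forall fun y =>
      (hgi y).aestronglyMeasurable_of_isCompact hK hK.measurableSet
  · exact (hgi x).integrableOn_compact hK
  · exact (hgi' x).aestronglyMeasurable_of_isCompact hK hK.measurableSet
  · refine (ae_restrict_iff' hK.measurableSet).2 (Eventually.of_forall fun t ht y hy => ?_)
    exact hC _ (mem_image_of_mem _ ⟨ht, hy⟩)
  · exact (continuousOn_const.integrableOn_compact hK)
  · exact Eventually.of_forall fun t y _ => hd t y

theorem exists_hasFDerivAt_setIntegral [ProperSpace V] [CompleteSpace G] {K : Set ℝ}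
    (hK : IsCompact K) {g : ℝ × V → G} {g' : ℝ × V → V →L[ℝ] G} (hg : Continuous g)
    (hg' : Continuous g') (hd : ∀ t x, HasFDerivAt (fun y => g (t, y)) (g' (t, x)) x) (x : V) :
    ∃ L : V →L[ℝ] G, HasFDerivAt (fun y => ∫ t in K, g (t, y)) L x ∧
      ∀ v, L v = ∫ t in K, g' (t, x) v := by
  refine ⟨_, hasFDerivAt_setIntegral_of_continuous hK hg hg' hd x, fun v => ?_⟩
  rw [ContinuousLinearMap.integral_apply]
  exact (hg'.comp (Continuous.prodMk continuous_id continuous_const)).continuousOn.integrableOn_compact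
    hK

theorem iteratedFDeriv_prodMk_left {U : Type*} [NormedAddCommGroup U] [NormedSpace ℝ U]
    {f : U × V → G} (hf : ContDiff ℝ ∞ f) (k : ℕ) (t : U) (x : V) :
    iteratedFDeriv ℝ k (fun y => f (t, y)) x =
      (iteratedFDeriv ℝ k f (t, x)).compContinuousLinearMap
        (fun _ => ContinuousLinearMap.inr ℝ U V) := by
  have h1 : (fun y => f (t, y)) =
      (fun z => f ((t, 0) + z)) ∘ ContinuousLinearMap.inr ℝ U V := by
    ext y; simp
  have h2 : ContDiff ℝ ∞ (fun z => f ((t, 0) + z)) := hf.comp (contDiff_const.add contDiff_id)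
  rw [h1, (ContinuousLinearMap.inr ℝ U V).iteratedFDeriv_comp_right h2 x (i := k)
    (by exact_mod_cast le_top), iteratedFDeriv_comp_add_left]
  simp

theorem continuous_iteratedFDeriv_prodMk {f : ℝ × V → G} (hf : ContDiff ℝ ∞ f) (k : ℕ) :
    Continuous (fun p : ℝ × V => iteratedFDeriv ℝ k (fun y => f (p.1, y)) p.2) := by
  simp_rw [iteratedFDeriv_prodMk_left hf]
  exact (ContinuousMultilinearMap.compContinuousLinearMapL (F := G)
    (fun _ : Fin k => ContinuousLinearMap.inr ℝ ℝ V)).continuous.comp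
    (hf.continuous_iteratedFDeriv (by exact_mod_cast le_top))

/-- The Taylor series is integrated term by term; uniqueness of Taylor series then yields both
smoothness and the commutation of `iteratedFDeriv` with the integral. -/
theorem hasFTaylorSeriesUpTo_integral_unit [ProperSpace V] [CompleteSpace G] {f : ℝ × V → G}
    (hf : ContDiff ℝ ∞ f) :
    HasFTaylorSeriesUpTo ∞ (fun x => ∫ t in Icc (0 : ℝ) 1, f (t, x))
      (fun x k => ∫ t in Icc (0 : ℝ) 1, iteratedFDeriv ℝ k (fun y => f (t, y)) x) := by
  have hsec : ∀ t, ContDiff ℝ ∞ (fun y => f (t, y)) := fun t =>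
    hf.comp (contDiff_const.prodMk contDiff_id)
  have hint : ∀ k x, IntegrableOn (fun t => iteratedFDeriv ℝ k (fun y => f (t, y)) x)
      (Icc (0 : ℝ) 1) := fun k x =>
    ((continuous_iteratedFDeriv_prodMk hf k).comp
      (Continuous.prodMk continuous_id continuous_const)).continuousOn.integrableOn_compact
      isCompact_Icc
  have hder : ∀ k x, HasFDerivAt
      (fun y => ∫ t in Icc (0 : ℝ) 1, iteratedFDeriv ℝ k (fun y => f (t, y)) y)
      (∫ t in Icc (0 : ℝ) 1, iteratedFDeriv ℝ (k + 1) (fun y => f (t, y)) x).curryLeft x := by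
    intro k x
    have hcl : Continuous (fun p : ℝ × V =>
        (iteratedFDeriv ℝ (k + 1) (fun y => f (p.1, y)) p.2).curryLeft) :=
      (continuousMultilinearCurryLeftEquiv ℝ (fun _ : Fin (k + 1) => V)
        G).continuous.comp (continuous_iteratedFDeriv_prodMk hf (k + 1))
    obtain ⟨L, hL, hLv⟩ := exists_hasFDerivAt_setIntegral isCompact_Icc
      (K := Icc (0 : ℝ) 1)
      (g := fun p : ℝ × V => iteratedFDeriv ℝ k (fun y => f (p.1, y)) p.2)
      (g' := fun p : ℝ × V => (iteratedFDeriv ℝ (k + 1) (fun y => f (p.1, y)) p.2).curryLeft)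
      (continuous_iteratedFDeriv_prodMk hf k) hcl
      (fun t y => ((hsec t).ftaylorSeries).fderiv k (by exact_mod_cast WithTop.coe_lt_top _) y) x
    have h1 : (∫ t in Icc (0 : ℝ) 1, iteratedFDeriv ℝ (k + 1) (fun y => f (t, y)) x).curryLeft
        = L := by
      ext v m
      have hiv : IntegrableOn
          (fun t => (iteratedFDeriv ℝ (k + 1) (fun y => f (t, y)) x).curryLeft v)
          (Icc (0 : ℝ) 1) :=
        ((hcl.clm_apply continuous_const).comp
          (Continuous.prodMk continuous_id continuous_const)).continuousOn.integrableOn_compact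
          isCompact_Icc
      rw [hLv, ContinuousMultilinearMap.integral_apply hiv,
        ContinuousMultilinearMap.curryLeft_apply,
        ContinuousMultilinearMap.integral_apply (hint (k + 1) x)]
      rfl
    rw [h1]
    exact hL
  refine ⟨fun x => ?_, fun k _ x => hder k x,
    fun k _ => continuous_iff_continuousAt.2 fun x => (hder k x).continuousAt⟩
  rw [ContinuousMultilinearMap.curry0, ContinuousMultilinearMap.integral_apply (hint 0 x)]
  rfl

theorem contDiff_integral_unit [ProperSpace V] [CompleteSpace G] {f : ℝ × V → G}
    (hf : ContDiff ℝ ∞ f) : ContDiff ℝ ∞ (fun x => ∫ t in Icc (0 : ℝ) 1, f (t, x)) :=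
  (hasFTaylorSeriesUpTo_integral_unit hf).contDiff

theorem iteratedFDeriv_integral_unit [ProperSpace V] [CompleteSpace G] {f : ℝ × V → G}
    (hf : ContDiff ℝ ∞ f) (k : ℕ) (x : V) :
    iteratedFDeriv ℝ k (fun x => ∫ t in Icc (0 : ℝ) 1, f (t, x)) x =
      ∫ t in Icc (0 : ℝ) 1, iteratedFDeriv ℝ k (fun y => f (t, y)) x :=
  ((hasFTaylorSeriesUpTo_integral_unit hf).eq_iteratedFDeriv (by exact_mod_cast le_top) x).symm

end ParametricIntegral

/-! ### Averages over segments ending at a moving centre -/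

section Average

variable {W E : Type*} [NormedAddCommGroup W] [NormedSpace ℝ W]
  [NormedAddCommGroup E] [NormedSpace ℝ E]

theorem norm_iteratedFDeriv_clm_le {V G : Type*} [NormedAddCommGroup V] [NormedSpace ℝ V]
    [NormedAddCommGroup G] [NormedSpace ℝ G] (L : V →L[ℝ] G) {k : ℕ} (hk : 1 ≤ k) (z : V) :
    ‖iteratedFDeriv ℝ k L z‖ ≤ ‖L‖ := by
  have hd : fderiv ℝ L = fun _ => L := funext fun z => L.fderiv
  obtain ⟨k, rfl⟩ := Nat.exists_eq_add_of_le' hk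
  rw [← norm_iteratedFDeriv_fderiv, hd]
  rcases k with _ | k
  · rw [norm_iteratedFDeriv_zero]
  · rw [iteratedFDeriv_const_of_ne (by omega)]
    simp

/-- The average of `a` over the segment from `(w, c w)` to `(w, x)`. -/
def avg (c : W → E) (a : ℝ → W × E → ℂ) (h : ℝ) (z : W × E) : ℂ :=
  ∫ t in Icc (0 : ℝ) 1, a h (z.1, (1 - t) • c z.1 + t • z.2)

variable {h₀ : ℝ} {a : ℝ → W × E → ℂ} {c : W → E}

theorem contDiff_segment (hc : ContDiff ℝ ∞ c) :
    ContDiff ℝ ∞ (fun p : ℝ × (W × E) => (p.2.1, (1 - p.1) • c p.2.1 + p.1 • p.2.2)) := by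
  fun_prop

/-- The segment map is linear plus `(1 - t)` times a function of `w` alone, so its derivatives are
bounded uniformly in `t` and in all `x`. The shape `D ^ i` is the one that
`norm_iteratedFDeriv_comp_le` requires. -/
theorem exists_bound_iteratedFDeriv_segment (hc : ContDiff ℝ ∞ c) {S : Set W} (hS : IsCompact S)
    (k : ℕ) : ∃ D : ℝ, 1 ≤ D ∧ ∀ t ∈ Icc (0 : ℝ) 1, ∀ w ∈ S, ∀ x : E, ∀ i, 1 ≤ i → i ≤ k →
      ‖iteratedFDeriv ℝ i (fun z : W × E => (z.1, (1 - t) • c z.1 + t • z.2)) (w, x)‖ ≤ D ^ i := by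
  set A := (ContinuousLinearMap.inl ℝ W E).comp (ContinuousLinearMap.fst ℝ W E) with hA
  set B := (ContinuousLinearMap.inr ℝ W E).comp (ContinuousLinearMap.snd ℝ W E) with hB
  set γ : W × E → W × E := fun z => ContinuousLinearMap.inr ℝ W E (c z.1) with hγ
  have sγ : ContDiff ℝ ∞ (fun w => ContinuousLinearMap.inr ℝ W E (c w)) :=
    (ContinuousLinearMap.contDiff _).comp hc
  have hbd : ∀ i, ∃ M : ℝ, ∀ w ∈ S, ∀ x : E, ‖iteratedFDeriv ℝ i γ (w, x)‖ ≤ M := by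
    intro i
    obtain ⟨M, hM⟩ := (hS.image_of_continuousOn (sγ.continuous_iteratedFDeriv (m := i)
      (by exact_mod_cast le_top)).continuousOn).isBounded.exists_norm_le
    refine ⟨‖ContinuousLinearMap.fst ℝ W E‖ ^ i * M, fun w hw x => ?_⟩
    refine (norm_iteratedFDeriv_comp_clm_le (ContinuousLinearMap.fst ℝ W E) sγ i _).trans ?_
    gcongr
    exact hM _ (mem_image_of_mem _ hw)
  choose M hM using hbd
  set R := ∑ i ∈ Finset.range (k + 1), |M i| with hR
  have hR0 : 0 ≤ R := Finset.sum_nonneg fun i _ => abs_nonneg _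
  refine ⟨1 + ‖A‖ + ‖B‖ + R, by linarith [norm_nonneg A, norm_nonneg B],
    fun t ht w hw x i hi hik => ?_⟩
  have h1 : (fun z : W × E => (z.1, (1 - t) • c z.1 + t • z.2)) =
      (A + t • B : W × E →L[ℝ] W × E) + (1 - t) • γ := by
    ext z
    · simp [hA, hB, hγ]
    · simp [hA, hB, hγ, add_comm]
  have h2 : ContDiff ℝ i γ := (sγ.comp contDiff_fst).of_le (by exact_mod_cast le_top)
  rw [h1, iteratedFDeriv_add_apply (ContinuousLinearMap.contDiff _).contDiffAt
    (show ContDiff ℝ i ((1 - t) • γ) from h2.const_smul (1 - t)).contDiffAt, iteratedFDeriv_const_smul_apply h2.contDiffAt]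
  have h3 : ‖iteratedFDeriv ℝ i (A + t • B : W × E →L[ℝ] W × E) (w, x)‖ ≤ ‖A‖ + ‖B‖ := by
    refine (norm_iteratedFDeriv_clm_le _ hi _).trans ((norm_add_le _ _).trans ?_)
    gcongr
    rw [norm_smul, Real.norm_of_nonneg ht.1]
    exact mul_le_of_le_one_left (norm_nonneg _) ht.2
  have h4 : ‖(1 - t) • iteratedFDeriv ℝ i γ (w, x)‖ ≤ R := by
    rw [norm_smul, Real.norm_of_nonneg (by linarith [ht.2])]
    refine (mul_le_of_le_one_left (norm_nonneg _) (by linarith [ht.1])).trans ?_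
    refine (hM i w hw x).trans ((le_abs_self _).trans ?_)
    exact Finset.single_le_sum (f := fun i => |M i|) (fun i _ => abs_nonneg _)
      (Finset.mem_range.2 (by omega))
  refine (norm_add_le _ _).trans ?_
  calc _ ≤ 1 + ‖A‖ + ‖B‖ + R := by linarith
    _ ≤ _ := le_self_pow₀ (by linarith [norm_nonneg A, norm_nonneg B]) (by omega)

theorem exists_bound_comp {k : ℕ} {N : ℕ} {S : Set W} (ha : TempOn h₀ S N a) :
    ∃ C : ℝ, 0 ≤ C ∧ ∀ i ≤ k, ∀ h ∈ Ioc 0 h₀, ∀ w ∈ S, ∀ x,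
      ‖iteratedFDeriv ℝ i (a h) (w, x)‖ ≤ C * (1 + ‖x‖) ^ N := by
  choose C hC0 hC using ha.exists_nonneg
  refine ⟨∑ i ∈ Finset.range (k + 1), C i, Finset.sum_nonneg fun i _ => hC0 i,
    fun i hi h hh w hw x => (hC i h hh w hw x).trans ?_⟩
  gcongr
  exact Finset.single_le_sum (fun i _ => hC0 i) (Finset.mem_range.2 (by omega))

/-- Averaging keeps the growth order `N`: points of the segment have norm at most a constant plus
`‖x‖`, the centre being bounded over `S`. -/
theorem TempOn.avg [ProperSpace W] [ProperSpace E] (hc : ContDiff ℝ ∞ c)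
    {N : ℕ} {S : Set W} (hS : IsCompact S) (ha : TempOn h₀ S N a) (sa : SmoothFam h₀ a) :
    TempOn h₀ S N (avg c a) := fun k => by
  obtain ⟨D, hD1, hD⟩ := exists_bound_iteratedFDeriv_segment hc hS k
  obtain ⟨C, hC0, hC⟩ := exists_bound_comp (k := k) ha
  obtain ⟨R, hR⟩ := (hS.image_of_continuousOn hc.continuous.continuousOn).isBounded.exists_norm_le
  refine ⟨k.factorial * (C * (1 + |R|) ^ N) * D ^ k, fun h hh w hw x => ?_⟩
  have hs := contDiff_segment hc
  have hf := (sa h hh).comp hs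
  have h1 := iteratedFDeriv_integral_unit hf k (w, x)
  change iteratedFDeriv ℝ k (TiltedFIO.avg c a h) (w, x) = _ at h1
  rw [h1]
  refine (norm_setIntegral_le_of_norm_le_const
    (C := k.factorial * (C * (1 + |R|) ^ N) * D ^ k * (1 + ‖x‖) ^ N) (by simp)
    fun t ht => ?_).trans (by simp)
  have hst : ContDiff ℝ ∞ (fun z : W × E => (z.1, (1 - t) • c z.1 + t • z.2)) :=
    hs.comp (contDiff_const.prodMk contDiff_id)
  refine (norm_iteratedFDeriv_comp_le (sa h hh) hst (n := k) (by exact_mod_cast le_top) (w, x)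
    (C := C * (1 + |R|) ^ N * (1 + ‖x‖) ^ N) (D := D) (fun i hi => ?_)
    (hD t ht w hw x)).trans_eq (by ring)
  refine (hC i hi h hh w hw _).trans ?_
  rw [mul_assoc, ← mul_pow]
  gcongr
  have h2 : ‖(1 - t) • c w + t • x‖ ≤ |R| + ‖x‖ := by
    refine (norm_add_le _ _).trans ?_
    rw [norm_smul, norm_smul, Real.norm_of_nonneg ht.1, Real.norm_of_nonneg (by linarith [ht.2])]
    gcongr
    · refine (mul_le_of_le_one_left (norm_nonneg _) (by linarith [ht.1])).trans ?_
      exact (hR _ (mem_image_of_mem _ hw)).trans (le_abs_self R)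
    · exact mul_le_of_le_one_left (norm_nonneg _) ht.2
  nlinarith [norm_nonneg x, abs_nonneg R]

theorem SmoothFam.avg [ProperSpace W] [ProperSpace E] (hc : ContDiff ℝ ∞ c)
    (sa : SmoothFam h₀ a) : SmoothFam h₀ (avg c a) := fun h hh =>
  contDiff_integral_unit ((sa h hh).comp (contDiff_segment hc))

theorem IsTempered.avg [ProperSpace W] [ProperSpace E] (hc : ContDiff ℝ ∞ c)
    (ha : IsTempered h₀ a) : IsTempered h₀ (avg c a) where
  smooth := ha.smooth.avg hc
  growth S hS := by
    obtain ⟨N, hN⟩ := ha.growth S hS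
    exact ⟨N, hN.avg hc hS ha.smooth⟩

/-- At `x = c w` every point of the segment equals `c w`, so only the motion of the centre depends
on `t`. The factor `1 / 2` is `∫₀¹ (1 - t) dt`. -/
theorem fderiv_avg_center [ProperSpace W] [ProperSpace E] (hc : ContDiff ℝ ∞ c) {h : ℝ}
    (sa : ContDiff ℝ ∞ (a h)) (w v : W) :
    fderiv ℝ (avg c a h) (w, c w) (v, 0) = fderiv ℝ (a h) (w, c w) (v, 0)
      + (1 / 2 : ℝ) • fderiv ℝ (a h) (w, c w) (0, fderiv ℝ c w v) := by
  set f : ℝ × (W × E) → ℂ := fun p => a h (p.2.1, (1 - p.1) • c p.2.1 + p.1 • p.2.2) with hf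
  have sf : ContDiff ℝ ∞ f := sa.comp (contDiff_segment hc)
  have hcd : Differentiable ℝ c := hc.differentiable (by simp)
  set g' : ℝ × (W × E) → (W × E →L[ℝ] ℂ) := fun p => (fderiv ℝ f p).comp
    (ContinuousLinearMap.inr ℝ ℝ (W × E)) with hg'
  have cg' : Continuous g' :=
    (sf.continuous_fderiv (by simp)).clm_comp continuous_const
  have hd : ∀ t x, HasFDerivAt (fun y => f (t, y)) (g' (t, x)) x := fun t x =>
    ((sf.differentiable (by simp)) (t, x)).hasFDerivAt.comp x (hasFDerivAt_prodMk_right t x)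
  have h1 := hasFDerivAt_setIntegral_of_continuous (μ := volume)
    (K := Icc (0 : ℝ) 1) isCompact_Icc (g := f) (g' := g')
    sf.continuous cg' hd (w, c w)
  have h2 : fderiv ℝ (avg c a h) (w, c w) = ∫ t in Icc (0 : ℝ) 1, g' (t, (w, c w)) := h1.fderiv
  have hint : IntegrableOn (fun t => g' (t, (w, c w))) (Icc (0 : ℝ) 1) :=
    (cg'.comp (Continuous.prodMk continuous_id continuous_const)).continuousOn.integrableOn_compact
      isCompact_Icc
  rw [h2, ContinuousLinearMap.integral_apply hint]
  have h3 : ∀ t : ℝ, g' (t, (w, c w)) (v, 0) = fderiv ℝ (a h) (w, c w) (v, 0)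
      + (1 - t) • fderiv ℝ (a h) (w, c w) (0, fderiv ℝ c w v) := by
    intro t
    have e : (1 - t) • c w + t • c w = c w := by rw [← add_smul]; simp
    have h4 : HasFDerivAt (fun z : W × E => (z.1, (1 - t) • c z.1 + t • z.2))
        ((ContinuousLinearMap.fst ℝ W E).prod ((1 - t) •
          (fderiv ℝ c w).comp (ContinuousLinearMap.fst ℝ W E)
            + t • ContinuousLinearMap.snd ℝ W E)) (w, c w) := by
      refine hasFDerivAt_fst.prodMk (HasFDerivAt.add (HasFDerivAt.const_smul ?_ _)
        (hasFDerivAt_snd.const_smul t))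
      exact (hcd w).hasFDerivAt.comp (w, c w) hasFDerivAt_fst
    have h5 : HasFDerivAt (a h) (fderiv ℝ (a h) (w, c w)) (w, (1 - t) • c w + t • c w) := by
      rw [e]; exact ((sa.differentiable (by simp)) _).hasFDerivAt
    have h6 := (hd t (w, c w)).unique (h5.comp (w, c w) h4)
    rw [h6]
    simp only [ContinuousLinearMap.comp_apply, ContinuousLinearMap.prod_apply,
      ContinuousLinearMap.coe_fst', add_apply, smul_apply, ContinuousLinearMap.coe_snd', smul_zero, add_zero]
    have h7 : (v, (1 - t) • fderiv ℝ c w v) =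
        (v, (0 : E)) + (1 - t) • ((0 : W), fderiv ℝ c w v) := by simp
    rw [h7, map_add, map_smul]
  simp_rw [h3]
  rw [integral_Icc_eq_integral_Ioc, ← intervalIntegral.integral_of_le zero_le_one,
    intervalIntegral.integral_add (by simp) (Continuous.intervalIntegrable (by fun_prop) _ _),
    intervalIntegral.integral_const, intervalIntegral.integral_smul_const]
  have h7 : ∫ t in (0 : ℝ)..1, (1 - t) = 1 / 2 := by
    rw [intervalIntegral.integral_sub (by simp) (by simp)]
    simp
    norm_num
  rw [h7]
  simp

end Average

/-! ### Hadamard's lemma around the critical point -/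

section Hadamard

variable {d : ℕ} {W : Type*} [NormedAddCommGroup W] [NormedSpace ℝ W]

/-- The coordinate vectors of `ℝ^d`. -/
abbrev ev (j : Fin d) : Eu d := EuclideanSpace.single j 1

theorem eq_sum_ev (x : Eu d) : x = ∑ j, x j • ev j := by
  ext i
  simp [Finset.sum_apply, Pi.single_apply]

/-- Fundamental theorem of calculus along the segment from `c w` to `x`. The factors `x j - c w j`
are those produced by the `η`-gradient of the phase, ready for integration by parts. -/
theorem hadamard_avg {c : W → Eu d} {a : ℝ → W × Eu d → ℂ} {h : ℝ}
    (sa : ContDiff ℝ ∞ (a h)) (w : W) (x : Eu d) :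
    a h (w, x) = a h (w, c w) + ∑ j, (((x j - c w j : ℝ)) : ℂ) *
      avg c (fun h z => fderiv ℝ (a h) z (0, ev j)) h (w, x) := by
  have hda := sa.differentiable (by simp)
  have hcont := sa.continuous_fderiv (by simp)
  have hp : ∀ t : ℝ, HasDerivAt (fun t : ℝ => a h (w, (1 - t) • c w + t • x))
      (fderiv ℝ (a h) (w, (1 - t) • c w + t • x) (0, x - c w)) t := by
    intro t
    refine (hda _).hasFDerivAt.comp_hasDerivAt t ?_
    refine (hasDerivAt_const t w).prodMk ?_
    have h1 : HasDerivAt (fun t : ℝ => (1 - t) • c w + t • x) ((-1 : ℝ) • c w + (1 : ℝ) • x) t :=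
      (((hasDerivAt_id t).const_sub 1).smul_const (c w)).add ((hasDerivAt_id t).smul_const x)
    have e : x - c w = (-1 : ℝ) • c w + (1 : ℝ) • x := by
      rw [neg_smul, one_smul, one_smul, sub_eq_neg_add]
    rw [e]
    exact h1
  have hsum : ∀ z, fderiv ℝ (a h) z (0, x - c w) =
      ∑ j, (((x j - c w j : ℝ)) : ℂ) * fderiv ℝ (a h) z (0, ev j) := by
    intro z
    conv_lhs => rw [eq_sum_ev (x - c w)]
    have : ((0 : W), ∑ j, (x - c w) j • ev j) = ∑ j, (x - c w) j • ((0 : W), ev j) := by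
      refine Prod.ext ?_ ?_ <;> simp [Prod.fst_sum, Prod.snd_sum]
    rw [this, map_sum]
    simp only [map_smul, PiLp.sub_apply, Complex.real_smul]
  have hseg : ∀ v : W × Eu d, Continuous fun t : ℝ =>
      fderiv ℝ (a h) (w, (1 - t) • c w + t • x) v := fun v =>
    (hcont.comp (by fun_prop)).clm_apply continuous_const
  have h2 := intervalIntegral.integral_eq_sub_of_hasDerivAt (a := 0) (b := 1)
    (fun t _ => hp t) ((hseg _).intervalIntegrable _ _)
  simp only [sub_self, zero_smul, one_smul, zero_add, sub_zero, add_zero] at h2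
  rw [← sub_eq_iff_eq_add', ← h2, intervalIntegral.integral_of_le zero_le_one,
    ← integral_Icc_eq_integral_Ioc]
  simp_rw [hsum, avg]
  rw [integral_finsetSum]
  · simp_rw [integral_const_mul]
  · intro j _
    exact ((hseg _).continuousOn.integrableOn_compact isCompact_Icc).const_mul _

end Hadamard

/-! ### The oscillating exponential -/

section Osc

theorem norm_osc (h t : ℝ) : ‖osc h t‖ = 1 := by
  have : Complex.I * (t : ℂ) / (h : ℂ) = ((t / h : ℝ) : ℂ) * Complex.I := by
    push_cast; ring
  rw [osc, this, Complex.norm_exp_ofReal_mul_I]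

theorem osc_add (h s t : ℝ) : osc h (s + t) = osc h s * osc h t := by
  rw [osc, osc, osc, ← Complex.exp_add]
  congr 1
  push_cast
  ring

theorem osc_zero (h : ℝ) : osc h 0 = 1 := by simp [osc]

theorem contDiff_osc (h : ℝ) : ContDiff ℝ ∞ (osc h) := by
  unfold osc
  exact ((contDiff_const.mul Complex.ofRealCLM.contDiff).div_const _).cexp

theorem hasDerivAt_osc (h t : ℝ) : HasDerivAt (osc h) (Complex.I / h * osc h t) t := by
  have h1 : HasDerivAt (fun t : ℝ => Complex.I * (t : ℂ) / (h : ℂ)) (Complex.I / h) t := by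
    simpa using ((Complex.ofRealCLM.hasDerivAt (x := t)).const_mul Complex.I).div_const (h : ℂ)
  have h2 := h1.cexp
  rw [mul_comm] at h2
  exact h2

end Osc

/-! ### The relative phase and its stationary point -/

section Phase

variable {d : ℕ}

theorem norm_le_sum_abs (x : Eu d) : ‖x‖ ≤ ∑ j, |x j| := by
  conv_lhs => rw [eq_sum_ev x]
  refine (norm_sum_le _ _).trans_eq ?_
  simp [norm_smul]

theorem integrable_inv_one_add_norm_pow :
    Integrable (fun x : Eu d => ((1 + ‖x‖) ^ (d + 1))⁻¹) := by
  have h1 := integrable_one_add_norm (E := Eu d) (μ := volume) (r := (d + 1 : ℕ))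
    (by simp)
  refine h1.congr (Filter.Eventually.of_forall fun x => ?_)
  simp only
  rw [Real.rpow_neg (by positivity), Real.rpow_natCast]

/-- The phase `φ(y, η) - φ(y, ξ) + ⟨η - ξ, x⟩` at `z = (((y, ξ), η), x)`. -/
def relPhase (φ : Eu d × Eu d → ℝ) (z : ((Eu d × Eu d) × Eu d) × Eu d) : ℝ :=
  φ (z.1.1.1, z.1.2) - φ z.1.1 + inner ℝ (z.1.2 - z.1.1.2) z.2

/-- The stationary point in `x` of the phase: minus the partial gradient of `φ` at `(y, η)`. -/
def crit (φ : Eu d × Eu d → ℝ) (w : (Eu d × Eu d) × Eu d) : Eu d :=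
  WithLp.toLp 2 fun j => -fderiv ℝ φ (w.1.1, w.2) (0, ev j)

variable {φ : Eu d × Eu d → ℝ}

theorem contDiff_relPhase (hφ : ContDiff ℝ ∞ φ) : ContDiff ℝ ∞ (relPhase φ) := by
  unfold relPhase
  refine ((hφ.comp ?_).sub (hφ.comp ?_)).add (ContDiff.inner ℝ ?_ ?_) <;> fun_prop

theorem contDiff_crit_apply (hφ : ContDiff ℝ ∞ φ) (j : Fin d) :
    ContDiff ℝ ∞ (fun q : Eu d × Eu d => -fderiv ℝ φ q (0, ev j)) :=
  ((hφ.fderiv_right (m := ∞) (by simp)).clm_apply contDiff_const).neg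

theorem contDiff_crit (hφ : ContDiff ℝ ∞ φ) : ContDiff ℝ ∞ (crit φ) := by
  refine contDiff_euclidean.2 fun j => ?_
  exact (contDiff_crit_apply hφ j).comp
    ((contDiff_fst.comp contDiff_fst).prodMk contDiff_snd)

theorem hasFDerivAt_relPhase_section (hφ : ContDiff ℝ ∞ φ) (p : Eu d × Eu d) (η x : Eu d) :
    HasFDerivAt (fun η => relPhase φ ((p, η), x))
      ((fderiv ℝ φ (p.1, η)).comp (ContinuousLinearMap.inr ℝ (Eu d) (Eu d)) + innerSL ℝ x) η := by
  have h1 : HasFDerivAt (fun η => φ (p.1, η))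
      ((fderiv ℝ φ (p.1, η)).comp (ContinuousLinearMap.inr ℝ (Eu d) (Eu d))) η :=
    ((hφ.differentiable (by simp)) _).hasFDerivAt.comp η (hasFDerivAt_prodMk_right p.1 η)
  have h2 : HasFDerivAt (fun η : Eu d => inner ℝ (η - p.2) x) (innerSL ℝ x) η := by
    have : (fun η : Eu d => inner ℝ (η - p.2) x) = fun η => innerSL ℝ x η - inner ℝ p.2 x := by
      ext η
      rw [inner_sub_left, innerSL_apply_apply, real_inner_comm]
    rw [this]
    exact (innerSL ℝ x).hasFDerivAt.sub_const _
  exact (h1.sub_const (φ p)).fun_add h2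

theorem hasFDerivAt_osc_relPhase_apply (hφ : ContDiff ℝ ∞ φ) (h : ℝ) (p : Eu d × Eu d)
    (η x : Eu d) (j : Fin d) :
    fderiv ℝ (fun η => osc h (relPhase φ ((p, η), x))) η (ev j) =
      Complex.I / h * ((x j - crit φ (p, η) j : ℝ) : ℂ) * osc h (relPhase φ ((p, η), x)) := by
  have h1 := (hasDerivAt_osc h (relPhase φ ((p, η), x))).hasFDerivAt.comp η
    (hasFDerivAt_relPhase_section hφ p η x)
  have h2 : fderiv ℝ (fun η => osc h (relPhase φ ((p, η), x))) η = _ := h1.fderiv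
  rw [h2]
  simp [crit, EuclideanSpace.inner_single_right]
  ring

end Phase

/-! ### The integral over `η` and integration by parts -/

section InnerIntegral

variable {d : ℕ}

/-- The integral over `η` of `e^{i Ψ / h} b`, at `p = (y, ξ)` and `x`. -/
def etaInt (φ : Eu d × Eu d → ℝ) (h : ℝ) (b : ((Eu d × Eu d) × Eu d) × Eu d → ℂ)
    (p : Eu d × Eu d) (x : Eu d) : ℂ :=
  ∫ η, osc h (relPhase φ ((p, η), x)) * b ((p, η), x)

/-- `b` vanishes unless `η ∈ κ`. -/
def EtaSupp (κ : Set (Eu d)) (b : ((Eu d × Eu d) × Eu d) × Eu d → ℂ) : Prop :=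
  ∀ p η x, η ∉ κ → b ((p, η), x) = 0

variable {φ : Eu d × Eu d → ℝ} {κ : Set (Eu d)}
  {b b' : ((Eu d × Eu d) × Eu d) × Eu d → ℂ} {h : ℝ}

theorem EtaSupp.fderiv_apply (hb : EtaSupp κ b) (hκ : IsCompact κ)
    (v : ((Eu d × Eu d) × Eu d) × Eu d) : EtaSupp κ (fun z => fderiv ℝ b z v) := by
  intro p η x hη
  have hopen : IsOpen {z : ((Eu d × Eu d) × Eu d) × Eu d | z.1.2 ∉ κ} :=
    hκ.isClosed.isOpen_compl.preimage (by fun_prop)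
  have h1 : b =ᶠ[nhds ((p, η), x)] fun _ => 0 := by
    have h2 : {z : ((Eu d × Eu d) × Eu d) × Eu d | z.1.2 ∉ κ} ∈ nhds ((p, η), x) :=
      hopen.mem_nhds hη
    filter_upwards [h2] with z hz
    exact hb z.1.1 z.1.2 z.2 hz
  change fderiv ℝ b ((p, η), x) v = 0
  rw [h1.fderiv_eq]
  simp

theorem EtaSupp.mul_left (hb : EtaSupp κ b) (m : ((Eu d × Eu d) × Eu d) × Eu d → ℂ) :
    EtaSupp κ (fun z => m z * b z) := fun p η x hη => by simp [hb p η x hη]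

theorem EtaSupp.add (hb : EtaSupp κ b) (hb' : EtaSupp κ b') :
    EtaSupp κ (fun z => b z + b' z) := fun p η x hη => by simp [hb p η x hη, hb' p η x hη]

theorem EtaSupp.hasCompactSupport (hb : EtaSupp κ b) (hκ : IsCompact κ) (p : Eu d × Eu d)
    (x : Eu d) : HasCompactSupport (fun η => b ((p, η), x)) :=
  HasCompactSupport.intro hκ fun η hη => hb p η x hη

theorem continuous_etaInt_integrand (hφ : ContDiff ℝ ∞ φ) (cb : Continuous b) (h : ℝ) :
    Continuous (fun q : (Eu d × Eu d) × Eu d × Eu d =>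
      osc h (relPhase φ ((q.1, q.2.2), q.2.1)) * b ((q.1, q.2.2), q.2.1)) := by
  have h1 := (contDiff_osc h).continuous
  have h2 := (contDiff_relPhase hφ).continuous
  fun_prop

theorem integrable_etaInt_integrand (hφ : ContDiff ℝ ∞ φ) (cb : Continuous b)
    (hb : EtaSupp κ b) (hκ : IsCompact κ) (h : ℝ) (p : Eu d × Eu d) (x : Eu d) :
    Integrable (fun η => osc h (relPhase φ ((p, η), x)) * b ((p, η), x)) := by
  refine Continuous.integrable_of_hasCompactSupport ?_ ?_
  · exact (continuous_etaInt_integrand hφ cb h).comp (f := fun η : Eu d => (p, x, η))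
      (by fun_prop)
  · exact (hb.hasCompactSupport hκ p x).mul_left

theorem etaInt_eq_setIntegral (hb : EtaSupp κ b) (p : Eu d × Eu d) (x : Eu d) :
    etaInt φ h b p x = ∫ η in κ, osc h (relPhase φ ((p, η), x)) * b ((p, η), x) := by
  rw [setIntegral_eq_integral_of_forall_compl_eq_zero]
  · rfl
  · intro η hη
    rw [hb p η x hη, mul_zero]

theorem continuous_etaInt (hφ : ContDiff ℝ ∞ φ) (cb : Continuous b)
    (hb : EtaSupp κ b) (hκ : IsCompact κ) (h : ℝ) :
    Continuous (fun q : (Eu d × Eu d) × Eu d => etaInt φ h b q.1 q.2) := by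
  simp_rw [etaInt_eq_setIntegral hb]
  refine continuous_parametric_integral_of_continuous ?_ hκ
  have := (continuous_etaInt_integrand hφ cb h)
  exact this.comp (f := fun q : ((Eu d × Eu d) × Eu d) × Eu d => (q.1.1, q.1.2, q.2))
    (by fun_prop)

theorem etaInt_add (hφ : ContDiff ℝ ∞ φ) (cb : Continuous b) (cb' : Continuous b')
    (hb : EtaSupp κ b) (hb' : EtaSupp κ b') (hκ : IsCompact κ) (p : Eu d × Eu d) (x : Eu d) :
    etaInt φ h (fun z => b z + b' z) p x = etaInt φ h b p x + etaInt φ h b' p x := by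
  unfold etaInt
  rw [← integral_add (integrable_etaInt_integrand hφ cb hb hκ h p x)
    (integrable_etaInt_integrand hφ cb' hb' hκ h p x)]
  simp_rw [mul_add]

theorem etaInt_const_mul (c : ℂ) (p : Eu d × Eu d) (x : Eu d) :
    etaInt φ h (fun z => c * b z) p x = c * etaInt φ h b p x := by
  unfold etaInt
  rw [← integral_const_mul]
  congr 1
  ext η
  ring

/-- The factor `x j - crit φ z.1 j` times the exponential is `-ih` times the `ηⱼ`-derivative of the
exponential. Compact support in `η` removes boundary terms. -/
theorem etaInt_ibp (hφ : ContDiff ℝ ∞ φ) (sb : ContDiff ℝ ∞ b) (hb : EtaSupp κ b)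
    (hκ : IsCompact κ) (hh : h ≠ 0) (p : Eu d × Eu d) (x : Eu d) (j : Fin d) :
    etaInt φ h (fun z => ((z.2 j - crit φ z.1 j : ℝ) : ℂ) * b z) p x =
      Complex.I * h * etaInt φ h (fun z => fderiv ℝ b z ((0, ev j), 0)) p x := by
  set f : Eu d → ℂ := fun η => osc h (relPhase φ ((p, η), x)) with hf
  set g : Eu d → ℂ := fun η => b ((p, η), x) with hg
  have sf : ContDiff ℝ ∞ f := (contDiff_osc h).comp ((contDiff_relPhase hφ).comp (by fun_prop))
  have sg : ContDiff ℝ ∞ g := sb.comp (by fun_prop)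
  have cg : HasCompactSupport g := hb.hasCompactSupport hκ p x
  have dg : ∀ η, fderiv ℝ g η (ev j) = fderiv ℝ b ((p, η), x) ((0, ev j), 0) := by
    intro η
    have h1 : HasFDerivAt (fun η : Eu d => ((p, η), x))
        ((ContinuousLinearMap.inl ℝ ((Eu d × Eu d) × Eu d) (Eu d)).comp
          (ContinuousLinearMap.inr ℝ (Eu d × Eu d) (Eu d))) η :=
      HasFDerivAt.comp (g := fun w => (w, x)) (f := fun η => (p, η)) η
        (hasFDerivAt_prodMk_left (p, η) x) (hasFDerivAt_prodMk_right p η)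
    have h2 := (((sb.differentiable (by simp)) ((p, η), x)).hasFDerivAt.comp η h1).fderiv
    change fderiv ℝ g η = _ at h2
    rw [h2]
    simp
  have df : ∀ η, fderiv ℝ f η (ev j) =
      Complex.I / h * ((x j - crit φ (p, η) j : ℝ) : ℂ) * f η := fun η =>
    hasFDerivAt_osc_relPhase_apply hφ h p η x j
  have cdf : Continuous (fun η => fderiv ℝ f η (ev j)) :=
    (sf.continuous_fderiv (by simp)).clm_apply continuous_const
  have cdg : Continuous (fun η => fderiv ℝ g η (ev j)) :=
    (sg.continuous_fderiv (by simp)).clm_apply continuous_const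
  have key := integral_mul_fderiv_eq_neg_fderiv_mul_of_integrable (μ := volume) (f := f) (g := g)
    (v := ev j)
    ((cdf.mul sg.continuous).integrable_of_hasCompactSupport cg.mul_left)
    ((sf.continuous.mul cdg).integrable_of_hasCompactSupport
      (HasCompactSupport.mul_left (by
        have := cg.fderiv_apply (𝕜 := ℝ) (ev j)
        exact this)))
    ((sf.continuous.mul sg.continuous).integrable_of_hasCompactSupport cg.mul_left)
    (fun η _ => sf.differentiable (by simp) η) (fun η _ => sg.differentiable (by simp) η)
  simp_rw [dg, df] at key
  unfold etaInt
  rw [key, mul_neg, ← integral_const_mul, ← integral_neg]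
  congr 1
  ext η
  simp only [hf, hg]
  have hc : (h : ℂ) ≠ 0 := by exact_mod_cast hh
  field_simp
  simp

end InnerIntegral

/-! ### Rapid decay in `x` of the integral over `η` -/

section Decay

variable {d : ℕ} {φ : Eu d × Eu d → ℝ} {κ : Set (Eu d)} {h₀ : ℝ}

theorem norm_etaInt_le_of_tempOn (hκ : IsCompact κ) {S : Set (Eu d × Eu d)} {N : ℕ}
    {a : ℝ → ((Eu d × Eu d) × Eu d) × Eu d → ℂ} (hs : ∀ h ∈ Ioc 0 h₀, EtaSupp κ (a h))
    (ha : TempOn h₀ (S ×ˢ κ) N a) :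
    ∃ C : ℝ, 0 ≤ C ∧ ∀ h ∈ Ioc 0 h₀, ∀ p ∈ S, ∀ x,
      ‖etaInt φ h (a h) p x‖ ≤ C * (1 + ‖x‖) ^ N := by
  obtain ⟨C, hC0, hC⟩ := ha.exists_nonneg 0
  refine ⟨C * volume.real κ, by positivity, fun h hh p hp x => ?_⟩
  rw [etaInt_eq_setIntegral (hs h hh)]
  refine (norm_setIntegral_le_of_norm_le_const (C := C * (1 + ‖x‖) ^ N)
    hκ.measure_lt_top fun η hη => ?_).trans_eq (by ring)
  rw [norm_mul, norm_osc, one_mul, ← norm_iteratedFDeriv_zero (𝕜 := ℝ) (f := a h)]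
  exact hC h hh (p, η) ⟨hp, hη⟩ x

/-- Rapid decay in `x` of the inner integral. -/
theorem etaInt_decay (hφ : ContDiff ℝ ∞ φ) (hκ : IsCompact κ) {S : Set (Eu d × Eu d)}
    {Y : Set (Eu d)} (hY : IsCompact Y) (hS : MapsTo Prod.fst S Y) (N L : ℕ) :
    ∀ a : ℝ → ((Eu d × Eu d) × Eu d) × Eu d → ℂ, SmoothFam h₀ a →
      (∀ h ∈ Ioc 0 h₀, EtaSupp κ (a h)) → TempOn h₀ (S ×ˢ κ) N a →
      ∃ C : ℝ, 0 ≤ C ∧ ∀ h ∈ Ioc 0 h₀, ∀ p ∈ S, ∀ x,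
        (1 + ‖x‖) ^ L * ‖etaInt φ h (a h) p x‖ ≤ C * (1 + ‖x‖) ^ N := by
  induction L with
  | zero =>
    intro a sa hs ha
    simpa using norm_etaInt_le_of_tempOn hκ hs ha
  | succ L ih =>
    intro a sa hs ha
    obtain ⟨C, hC0, hC⟩ := ih a sa hs ha
    set L₀ : (Eu d × Eu d) × Eu d →L[ℝ] Eu d × Eu d :=
      ((ContinuousLinearMap.fst ℝ _ _).comp (ContinuousLinearMap.fst ℝ _ _)).prod
        (ContinuousLinearMap.snd ℝ _ _) with hL₀
    set T : Fin d → ℝ → ((Eu d × Eu d) × Eu d) × Eu d → ℂ := fun j h z =>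
      Complex.I * h * fderiv ℝ (a h) z ((0, ev j), 0) + ((crit φ z.1 j : ℝ) : ℂ) * a h z with hT
    have hm : ∀ j : Fin d, ContDiff ℝ ∞
        (fun q : Eu d × Eu d => ((-fderiv ℝ φ q (0, ev j) : ℝ) : ℂ)) := fun j =>
      Complex.ofRealCLM.contDiff.comp (contDiff_crit_apply hφ j)
    have sB : ∀ j : Fin d, SmoothFam h₀
        (fun _ (z : ((Eu d × Eu d) × Eu d) × Eu d) => ((crit φ z.1 j : ℝ) : ℂ)) := fun j h hh =>
      ((hm j).comp L₀.contDiff).comp contDiff_fst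
    have tB : ∀ j : Fin d, TempOn h₀ (S ×ˢ κ) 0
        (fun _ (z : ((Eu d × Eu d) × Eu d) × Eu d) => ((crit φ z.1 j : ℝ) : ℂ)) := fun j =>
      TempOn.base (hm j) L₀ (hY.prod hκ) (fun w hw => mk_mem_prod (hS (show w.1 ∈ S from hw.1)) hw.2)
    have hc : ∀ h ∈ Ioc 0 h₀, ‖Complex.I * (h : ℂ)‖ ≤ h₀ := fun h hh => by
      simpa [abs_of_pos hh.1] using hh.2
    have sD := fun j : Fin d => (sa.fderiv_apply ((0, ev j), 0)).const_mul
      (fun h => Complex.I * (h : ℂ))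
    have sM := fun j : Fin d => (sB j).mul sa
    have sT : ∀ j, SmoothFam h₀ (T j) := fun j => (sD j).add (sM j)
    have tT : ∀ j, TempOn h₀ (S ×ˢ κ) N (T j) := fun j => by
      refine TempOn.add (((ha.fderiv_apply sa ((0, ev j), 0)).const_mul (sa.fderiv_apply _) hc))
        ?_ (sD j) (sM j)
      simpa using (tB j).mul ha (sB j) sa
    have eD : ∀ h ∈ Ioc 0 h₀, ∀ j : Fin d, EtaSupp κ
        (fun z => Complex.I * h * fderiv ℝ (a h) z ((0, ev j), 0)) := fun h hh j =>
      ((hs h hh).fderiv_apply hκ _).mul_left _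
    have eM : ∀ h ∈ Ioc 0 h₀, ∀ j : Fin d, EtaSupp κ
        (fun z => ((crit φ z.1 j : ℝ) : ℂ) * a h z) := fun h hh j =>
      (hs h hh).mul_left _
    have eT : ∀ j, ∀ h ∈ Ioc 0 h₀, EtaSupp κ (T j h) := fun j h hh => (eD h hh j).add (eM h hh j)
    choose D hD0 hD using fun j => ih (T j) (sT j) (eT j) (tT j)
    refine ⟨C + ∑ j, D j, add_nonneg hC0 (Finset.sum_nonneg fun j _ => hD0 j),
      fun h hh p hp x => ?_⟩
    -- Write `xⱼ = (xⱼ - critⱼ) + critⱼ` and integrate the first part by parts. The new amplitude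
    -- has the same growth order `N`, since `critⱼ` is bounded over `S ×ˢ κ`; each power of `‖x‖` is
    -- thus gained at no cost.
    have hx : ∀ j, (x j : ℂ) * etaInt φ h (a h) p x = etaInt φ h (T j h) p x := by
      intro j
      have hne : h ≠ 0 := hh.1.ne'
      rw [hT, etaInt_add hφ (sD j h hh).continuous (sM j h hh).continuous (eD h hh j) (eM h hh j)
        hκ, etaInt_const_mul, ← etaInt_ibp hφ (sa h hh) (hs h hh) hκ hne p x j,
        ← etaInt_add hφ ?_ (sM j h hh).continuous ((hs h hh).mul_left _) (eM h hh j) hκ,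
        ← etaInt_const_mul]
      · unfold etaInt
        congr 1
        ext η
        push_cast
        ring
      · have h1 := (sa h hh).continuous
        have h2 := (contDiff_crit hφ).continuous
        refine Continuous.mul (Complex.continuous_ofReal.comp ?_) h1
        have h3 : Continuous (fun z : ((Eu d × Eu d) × Eu d) × Eu d => crit φ z.1 j) :=
          (EuclideanSpace.proj (𝕜 := ℝ) j).continuous.comp (h2.comp continuous_fst)
        have h4 : Continuous (fun z : ((Eu d × Eu d) × Eu d) × Eu d => z.2 j) :=
          (EuclideanSpace.proj (𝕜 := ℝ) j).continuous.comp continuous_snd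
        exact h4.sub h3
    have h1 : 1 + ‖x‖ ≤ 1 + ∑ j, |x j| := by linarith [norm_le_sum_abs x]
    calc (1 + ‖x‖) ^ (L + 1) * ‖etaInt φ h (a h) p x‖
        = (1 + ‖x‖) * ((1 + ‖x‖) ^ L * ‖etaInt φ h (a h) p x‖) := by ring
      _ ≤ (1 + ∑ j, |x j|) * ((1 + ‖x‖) ^ L * ‖etaInt φ h (a h) p x‖) := by gcongr
      _ = (1 + ‖x‖) ^ L * ‖etaInt φ h (a h) p x‖ +
            ∑ j, (1 + ‖x‖) ^ L * ‖etaInt φ h (T j h) p x‖ := by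
          rw [add_mul, one_mul, Finset.sum_mul]
          congr 1
          refine Finset.sum_congr rfl fun j _ => ?_
          rw [← hx, norm_mul, Complex.norm_real, Real.norm_eq_abs]
          ring
      _ ≤ C * (1 + ‖x‖) ^ N + ∑ j, D j * (1 + ‖x‖) ^ N := by
          exact add_le_add (hC h hh p hp x) (Finset.sum_le_sum fun j _ => hD j h hh p hp x)
      _ = _ := by rw [add_mul, Finset.sum_mul]

theorem etaInt_decay' (hφ : ContDiff ℝ ∞ φ) (hκ : IsCompact κ) {S : Set (Eu d × Eu d)}
    {Y : Set (Eu d)} (hY : IsCompact Y) (hS : MapsTo Prod.fst S Y) {N : ℕ}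
    {a : ℝ → ((Eu d × Eu d) × Eu d) × Eu d → ℂ} (sa : SmoothFam h₀ a)
    (hs : ∀ h ∈ Ioc 0 h₀, EtaSupp κ (a h)) (ha : TempOn h₀ (S ×ˢ κ) N a) :
    ∃ C : ℝ, 0 ≤ C ∧ ∀ h ∈ Ioc 0 h₀, ∀ p ∈ S, ∀ x,
        ‖etaInt φ h (a h) p x‖ ≤ C * ((1 + ‖x‖) ^ (d + 1))⁻¹ := by
  -- `N` of the powers cancel the growth of the amplitude, and the other `d + 1` form an integrable
  -- weight on `ℝ^d`.
  obtain ⟨C, hC0, hC⟩ := etaInt_decay hφ hκ hY hS N (N + (d + 1)) a sa hs ha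
  refine ⟨C, hC0, fun h hh p hp x => ?_⟩
  have h1 := hC h hh p hp x
  have h2 : 0 < (1 + ‖x‖) ^ N := by positivity
  have h3 : 0 < (1 + ‖x‖) ^ (d + 1) := by positivity
  rw [pow_add, mul_assoc, mul_comm C, mul_le_mul_iff_right₀ h2] at h1
  rw [← div_eq_mul_inv, le_div_iff₀ h3]
  linarith

end Decay

/-! ### Amplitudes and oscillatory integrals -/

section Amplitude

variable {d : ℕ}

/-- Tempered families of functions of `(((y, ξ), η), x)` that vanish unless `η ∈ κ`. -/
structure IsAmplitude (h₀ : ℝ) (κ : Set (Eu d))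
    (a : ℝ → ((Eu d × Eu d) × Eu d) × Eu d → ℂ) : Prop where
  tempered : IsTempered h₀ a
  supp : ∀ h ∈ Ioc 0 h₀, EtaSupp κ (a h)

/-- The oscillatory integral `(2πh)^{-d} ∫∫ e^{i Ψ / h} b dη dx`. -/
def oscInt (φ : Eu d × Eu d → ℝ) (h : ℝ) (b : ((Eu d × Eu d) × Eu d) × Eu d → ℂ)
    (p : Eu d × Eu d) : ℂ :=
  (((2 * Real.pi * h) ^ d)⁻¹ : ℝ) * ∫ x, etaInt φ h b p x

variable {φ : Eu d × Eu d → ℝ} {κ : Set (Eu d)} {h₀ h : ℝ}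
  {a a' : ℝ → ((Eu d × Eu d) × Eu d) × Eu d → ℂ}

namespace IsAmplitude

theorem add (ha : IsAmplitude h₀ κ a) (ha' : IsAmplitude h₀ κ a') :
    IsAmplitude h₀ κ (fun h z => a h z + a' h z) :=
  ⟨ha.tempered.add ha'.tempered, fun h hh => (ha.supp h hh).add (ha'.supp h hh)⟩

theorem const_mul (ha : IsAmplitude h₀ κ a) {c : ℝ → ℂ} {R : ℝ}
    (hc : ∀ h ∈ Ioc 0 h₀, ‖c h‖ ≤ R) : IsAmplitude h₀ κ (fun h z => c h * a h z) :=
  ⟨ha.tempered.const_mul hc, fun h hh => (ha.supp h hh).mul_left _⟩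

theorem mul_left (ha : IsAmplitude h₀ κ a) (ha' : IsTempered h₀ a') :
    IsAmplitude h₀ κ (fun h z => a' h z * a h z) :=
  ⟨ha'.mul ha.tempered, fun h hh => (ha.supp h hh).mul_left _⟩

theorem fderiv_apply (ha : IsAmplitude h₀ κ a) (hκ : IsCompact κ)
    (v : ((Eu d × Eu d) × Eu d) × Eu d) : IsAmplitude h₀ κ (fun h z => fderiv ℝ (a h) z v) :=
  ⟨ha.tempered.fderiv_apply v, fun h hh => (ha.supp h hh).fderiv_apply hκ v⟩

theorem sum {ι : Type*} (s : Finset ι) {f : ι → ℝ → ((Eu d × Eu d) × Eu d) × Eu d → ℂ}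
    (hf : ∀ i, IsAmplitude h₀ κ (f i)) : IsAmplitude h₀ κ (fun h z => ∑ i ∈ s, f i h z) :=
  ⟨IsTempered.sum s fun i => (hf i).tempered, fun h hh p η x hη =>
    Finset.sum_eq_zero fun i _ => (hf i).supp h hh p η x hη⟩

theorem avg (ha : IsAmplitude h₀ κ a) {c : (Eu d × Eu d) × Eu d → Eu d} (hc : ContDiff ℝ ∞ c) :
    IsAmplitude h₀ κ (avg c a) :=
  ⟨ha.tempered.avg hc, fun h hh p η x hη => by
    simp [TiltedFIO.avg, fun y => ha.supp h hh p η y hη]⟩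

theorem smooth (ha : IsAmplitude h₀ κ a) (hh : h ∈ Ioc 0 h₀) : ContDiff ℝ ∞ (a h) :=
  ha.tempered.smooth h hh

theorem etaInt_bound (ha : IsAmplitude h₀ κ a) (hφ : ContDiff ℝ ∞ φ) (hκ : IsCompact κ)
    {S : Set (Eu d × Eu d)} (hS : IsCompact S) :
    ∃ C : ℝ, 0 ≤ C ∧ ∀ h ∈ Ioc 0 h₀, ∀ p ∈ S, ∀ x,
      ‖etaInt φ h (a h) p x‖ ≤ C * ((1 + ‖x‖) ^ (d + 1))⁻¹ := by
  obtain ⟨N, hN⟩ := ha.tempered.growth (S ×ˢ κ) (hS.prod hκ)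
  exact etaInt_decay' hφ hκ (hS.image continuous_fst) (mapsTo_image _ _) ha.tempered.smooth
    ha.supp hN

theorem continuous_etaInt (ha : IsAmplitude h₀ κ a) (hφ : ContDiff ℝ ∞ φ) (hκ : IsCompact κ)
    (hh : h ∈ Ioc 0 h₀) (p : Eu d × Eu d) : Continuous (etaInt φ h (a h) p) :=
  (TiltedFIO.continuous_etaInt hφ (ha.smooth hh).continuous (ha.supp h hh) hκ h).comp
    (f := fun x : Eu d => (p, x)) (by fun_prop)

theorem integrable_etaInt (ha : IsAmplitude h₀ κ a) (hφ : ContDiff ℝ ∞ φ) (hκ : IsCompact κ)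
    (hh : h ∈ Ioc 0 h₀) (p : Eu d × Eu d) : Integrable (etaInt φ h (a h) p) := by
  obtain ⟨C, -, hC⟩ := ha.etaInt_bound hφ hκ (isCompact_singleton (x := p))
  refine (integrable_inv_one_add_norm_pow.const_mul C).mono'
    (ha.continuous_etaInt hφ hκ hh p).aestronglyMeasurable ?_
  exact Filter.Eventually.of_forall fun x => hC h hh p rfl x

theorem oscInt_add (ha : IsAmplitude h₀ κ a) (ha' : IsAmplitude h₀ κ a') (hφ : ContDiff ℝ ∞ φ)
    (hκ : IsCompact κ) (hh : h ∈ Ioc 0 h₀) (p : Eu d × Eu d) :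
    oscInt φ h (fun z => a h z + a' h z) p = oscInt φ h (a h) p + oscInt φ h (a' h) p := by
  unfold oscInt
  rw [← mul_add, ← integral_add (ha.integrable_etaInt hφ hκ hh p)
    (ha'.integrable_etaInt hφ hκ hh p)]
  congr 2
  ext x
  exact etaInt_add hφ (ha.smooth hh).continuous (ha'.smooth hh).continuous (ha.supp h hh)
    (ha'.supp h hh) hκ p x

end IsAmplitude

theorem oscInt_const_mul (c : ℂ) (b : ((Eu d × Eu d) × Eu d) × Eu d → ℂ) (p : Eu d × Eu d) :
    oscInt φ h (fun z => c * b z) p = c * oscInt φ h b p := by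
  unfold oscInt
  simp_rw [etaInt_const_mul, integral_const_mul]
  ring

/-- The uniform bound `O(h^{-d})` of oscillatory integrals. -/
theorem IsAmplitude.oscInt_bound (ha : IsAmplitude h₀ κ a) (hφ : ContDiff ℝ ∞ φ)
    (hκ : IsCompact κ) {S : Set (Eu d × Eu d)} (hS : IsCompact S) :
    ∃ C : ℝ, 0 ≤ C ∧ ∀ h ∈ Ioc 0 h₀, ∀ p ∈ S, ‖oscInt φ h (a h) p‖ ≤ C * h⁻¹ ^ d := by
  obtain ⟨C, hC0, hC⟩ := ha.etaInt_bound hφ hκ hS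
  set I := ∫ x : Eu d, ((1 + ‖x‖) ^ (d + 1))⁻¹ with hI
  have hI0 : 0 ≤ I := integral_nonneg fun x => by positivity
  refine ⟨((2 * Real.pi) ^ d)⁻¹ * (C * I), by positivity, fun h hh p hp => ?_⟩
  have h1 : ‖∫ x, etaInt φ h (a h) p x‖ ≤ C * I := by
    rw [hI, ← integral_const_mul]
    exact norm_integral_le_of_norm_le (integrable_inv_one_add_norm_pow.const_mul C)
      (Filter.Eventually.of_forall fun x => hC h hh p hp x)
  have h0 : 0 < h := hh.1
  rw [oscInt, norm_mul, Complex.norm_real, Real.norm_of_nonneg (by positivity), mul_pow, mul_inv,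
    inv_pow]
  calc _ ≤ ((2 * Real.pi) ^ d)⁻¹ * (h ^ d)⁻¹ * (C * I) := by gcongr
    _ = _ := by ring

end Amplitude

/-! ### Amplitudes independent of `x`: Fourier inversion -/

section Inversion

variable {d : ℕ} {φ : Eu d × Eu d → ℝ} {κ : Set (Eu d)} {h : ℝ}

open FourierTransform in
-- When the amplitude does not involve `x`, the double integral is the Fourier inversion formula at
-- `ξ` for `v(η) = e^{i(φ(y,η)-φ(y,ξ))/h} m`, and the exponential is `1` at `η = ξ`. Hence the
-- identity is exact, with no remainder in `h`.
theorem oscInt_base (hφ : ContDiff ℝ ∞ φ) (hκ : IsCompact κ) (hh : 0 < h)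
    {m : (Eu d × Eu d) × Eu d → ℂ} (hm : ContDiff ℝ ∞ m) (hs : ∀ p, ∀ η ∉ κ, m (p, η) = 0)
    (p : Eu d × Eu d) : oscInt φ h (fun z => m z.1) p = m (p, p.2) := by
  have ha : IsAmplitude h κ (fun _ (z : ((Eu d × Eu d) × Eu d) × Eu d) => m z.1) :=
    ⟨IsTempered.base hm, fun _ _ p η _ hη => hs p η hη⟩
  have hmem : h ∈ Ioc 0 h := ⟨hh, le_rfl⟩
  set v : Eu d → ℂ := fun η => osc h (φ (p.1, η) - φ p) * m (p, η) with hv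
  have cv : Continuous v := by
    have h1 := (contDiff_osc h).continuous
    have h2 := hφ.continuous
    have h3 := hm.continuous
    fun_prop
  have iv : Integrable v := cv.integrable_of_hasCompactSupport
    (HasCompactSupport.intro hκ fun η hη => by simp [hv, hs p η hη])
  -- With `x = R • k` the factor `e^{i⟨η-ξ, x⟩/h}` becomes `e^{-2πi⟨η-ξ, k⟩}`, and the Jacobian `|R
  -- ^ d|⁻¹` is exactly the prefactor of `oscInt`.
  set R : ℝ := -(2 * Real.pi * h) with hR
  have hR0 : R ≠ 0 := by
    have := Real.pi_pos
    exact neg_ne_zero.2 (by positivity)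
  have key : ∀ k : Eu d, etaInt φ h (fun z => m z.1) p (R • k) =
      Real.fourierChar (inner ℝ k p.2) • 𝓕 v k := by
    intro k
    rw [Real.fourier_eq, etaInt, Circle.smul_def, ← integral_smul]
    congr 1
    ext η
    have e1 : relPhase φ ((p, η), R • k) = (φ (p.1, η) - φ p) + inner ℝ (η - p.2) (R • k) := rfl
    rw [e1, osc_add, hv]
    have e2 : osc h (inner ℝ (η - p.2) (R • k)) =
        (Real.fourierChar (inner ℝ k p.2) : ℂ) * (Real.fourierChar (-inner ℝ η k) : ℂ) := by
      rw [Real.fourierChar_apply, Real.fourierChar_apply, ← Complex.exp_add, osc]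
      congr 1
      rw [inner_smul_right, inner_sub_left, real_inner_comm k p.2, hR]
      have hc : (h : ℂ) ≠ 0 := by exact_mod_cast hh.ne'
      push_cast
      field_simp
      ring
    rw [e2, Circle.smul_def, smul_eq_mul, smul_eq_mul]
    ring
  -- Up to a unimodular factor, `𝓕 v` is the rescaled inner integral, which is already known to be
  -- integrable in `x`.
  have iF : Integrable (𝓕 v) := by
    have h1 := (ha.integrable_etaInt hφ hκ hmem p).comp_smul hR0
    simp_rw [key] at h1
    have h2 := (integrable_norm_iff (by
      exact (VectorFourier.fourierIntegral_continuous Real.continuous_fourierChar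
        (by exact continuous_inner) iv).aestronglyMeasurable)).1 (h1.norm.congr
          (Filter.Eventually.of_forall fun k => by
            simp only [Circle.norm_smul]; rfl) : Integrable fun k => ‖𝓕 v k‖)
    exact h2
  have inv := congrFun (cv.fourierInv_fourier_eq iv iF) p.2
  rw [Real.fourierInv_eq] at inv
  have cs := Measure.integral_comp_smul (volume : Measure (Eu d))
    (fun x => etaInt φ h (fun z => m z.1) p x) R
  simp_rw [key] at cs
  rw [inv] at cs
  have hRd : |(R ^ d)⁻¹| = ((2 * Real.pi * h) ^ d)⁻¹ := by
    have := Real.pi_pos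
    rw [abs_inv, abs_pow, hR, abs_neg, abs_of_pos (by positivity)]
  rw [finrank_euclideanSpace_fin, hRd] at cs
  have e3 : oscInt φ h (fun z => m z.1) p = v p.2 := by
    rw [cs, oscInt, Complex.real_smul]
  rw [e3, hv]
  simp [osc_zero]

end Inversion

/-! ### The exact first order expansion -/

section Recursion

variable {d : ℕ} {φ : Eu d × Eu d → ℝ} {κ : Set (Eu d)} {h₀ h : ℝ}
  {a : ℝ → ((Eu d × Eu d) × Eu d) × Eu d → ℂ}

/-- The value of `b` at the critical point `η = ξ`, `x = -∂_η φ(y, ξ)`. -/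
def critVal (φ : Eu d × Eu d → ℝ) (b : ((Eu d × Eu d) × Eu d) × Eu d → ℂ)
    (p : Eu d × Eu d) : ℂ := b ((p, p.2), crit φ (p, p.2))

/-- The amplitude of the first order remainder. -/
def nextAmp (φ : Eu d × Eu d → ℝ) (a : ℝ → ((Eu d × Eu d) × Eu d) × Eu d → ℂ) (h : ℝ)
    (z : ((Eu d × Eu d) × Eu d) × Eu d) : ℂ :=
  ∑ j, fderiv ℝ (TiltedFIO.avg (crit φ) (fun h z => fderiv ℝ (a h) z (0, ev j)) h) z ((0, ev j), 0)

theorem IsAmplitude.nextAmp (ha : IsAmplitude h₀ κ a) (hφ : ContDiff ℝ ∞ φ)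
    (hκ : IsCompact κ) : IsAmplitude h₀ κ (nextAmp φ a) :=
  IsAmplitude.sum _ fun j =>
    ((ha.fderiv_apply hκ (0, ev j)).avg (contDiff_crit hφ)).fderiv_apply hκ ((0, ev j), 0)

theorem etaInt_sum {ι : Type*} (s : Finset ι) {f : ι → ((Eu d × Eu d) × Eu d) × Eu d → ℂ}
    (hφ : ContDiff ℝ ∞ φ) (hκ : IsCompact κ) (cf : ∀ i, Continuous (f i))
    (hf : ∀ i, EtaSupp κ (f i)) (p : Eu d × Eu d) (x : Eu d) :
    etaInt φ h (fun z => ∑ i ∈ s, f i z) p x = ∑ i ∈ s, etaInt φ h (f i) p x := by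
  unfold etaInt
  rw [← integral_finsetSum]
  · simp_rw [Finset.mul_sum]
  · exact fun i _ => integrable_etaInt_integrand hφ (cf i) (hf i) hκ h p x

/-- Hadamard's lemma followed by one integration by parts in each coordinate, before any integration
in `x`. -/
theorem IsAmplitude.etaInt_eq (ha : IsAmplitude h₀ κ a) (hφ : ContDiff ℝ ∞ φ)
    (hκ : IsCompact κ) (hh : h ∈ Ioc 0 h₀) (p : Eu d × Eu d) (x : Eu d) :
    etaInt φ h (a h) p x = etaInt φ h (fun z => a h (z.1, crit φ z.1)) p x +
      Complex.I * h * etaInt φ h (TiltedFIO.nextAmp φ a h) p x := by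
  have hb := fun j : Fin d => (ha.fderiv_apply hκ (0, ev j)).avg (contDiff_crit hφ)
  have hb' := fun j : Fin d => (hb j).fderiv_apply hκ ((0, ev j), 0)
  have cc := (contDiff_crit hφ).continuous
  have cx : ∀ j : Fin d, Continuous (fun z : ((Eu d × Eu d) × Eu d) × Eu d =>
      ((z.2 j - crit φ z.1 j : ℝ) : ℂ)) := fun j =>
    Complex.continuous_ofReal.comp (((EuclideanSpace.proj (𝕜 := ℝ) j).continuous.comp
      continuous_snd).sub ((EuclideanSpace.proj (𝕜 := ℝ) j).continuous.comp
        (cc.comp continuous_fst)))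
  have e1 : a h = fun z => a h (z.1, crit φ z.1) + ∑ j, ((z.2 j - crit φ z.1 j : ℝ) : ℂ) *
      TiltedFIO.avg (crit φ) (fun h z => fderiv ℝ (a h) z (0, ev j)) h z := by
    ext z
    exact hadamard_avg (ha.smooth hh) z.1 z.2
  have e2 : etaInt φ h (TiltedFIO.nextAmp φ a h) p x = ∑ j, etaInt φ h (fun z =>
      fderiv ℝ (TiltedFIO.avg (crit φ) (fun h z => fderiv ℝ (a h) z (0, ev j)) h) z ((0, ev j), 0)) p x :=
    etaInt_sum Finset.univ hφ hκ (fun j => ((hb' j).smooth hh).continuous)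
      (fun j => (hb' j).supp h hh) p x
  conv_lhs => rw [e1]
  rw [e2, Finset.mul_sum, etaInt_add (κ := κ) hφ _ _ _ _ hκ, etaInt_sum (κ := κ) _ hφ hκ]
  · congr 1
    refine Finset.sum_congr rfl fun j _ => ?_
    exact etaInt_ibp hφ ((hb j).smooth hh) ((hb j).supp h hh) hκ hh.1.ne' p x j
  · exact fun j => (cx j).mul ((hb j).smooth hh).continuous
  · exact fun j => ((hb j).supp h hh).mul_left _
  · have := (ha.smooth hh).continuous
    fun_prop
  · exact continuous_finsetSum _ fun j _ => (cx j).mul ((hb j).smooth hh).continuous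
  · exact fun p η x hη => ha.supp h hh p η _ hη
  · exact fun p η x hη => Finset.sum_eq_zero fun j _ => by
      rw [(hb j).supp h hh p η x hη, mul_zero]

/-- First order expansion of an oscillatory integral. -/
theorem IsAmplitude.oscInt_eq (ha : IsAmplitude h₀ κ a) (hφ : ContDiff ℝ ∞ φ)
    (hκ : IsCompact κ) (hh : h ∈ Ioc 0 h₀) (p : Eu d × Eu d) :
    oscInt φ h (a h) p = critVal φ (a h) p +
      Complex.I * h * oscInt φ h (TiltedFIO.nextAmp φ a h) p := by
  have sm : ContDiff ℝ ∞ (fun w => a h (w, crit φ w)) :=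
    (ha.smooth hh).comp (contDiff_id.prodMk (contDiff_crit hφ))
  have hs : ∀ p, ∀ η ∉ κ, a h ((p, η), crit φ (p, η)) = 0 := fun p η hη =>
    ha.supp h hh p η _ hη
  have hm : IsAmplitude h₀ κ
      (fun _ (z : ((Eu d × Eu d) × Eu d) × Eu d) => a h (z.1, crit φ z.1)) :=
    ⟨IsTempered.base sm, fun _ _ p η _ hη => hs p η hη⟩
  have e1 := oscInt_base hφ hκ hh.1 sm hs p
  change _ = critVal φ (a h) p at e1
  rw [← e1]
  unfold oscInt
  simp_rw [ha.etaInt_eq hφ hκ hh]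
  rw [integral_add (hm.integrable_etaInt hφ hκ hh p)
    (((ha.nextAmp hφ hκ).integrable_etaInt hφ hκ hh p).const_mul _), integral_const_mul]
  ring

/-- Over a compact set of `p` the critical point stays bounded, so the polynomial weight in `x` is a
constant and the bound loses no power of `h`. -/
theorem IsAmplitude.critVal_bound (ha : IsAmplitude h₀ κ a) (hφ : ContDiff ℝ ∞ φ)
    {S : Set (Eu d × Eu d)} (hS : IsCompact S) (k : ℕ) :
    ∃ C : ℝ, 0 ≤ C ∧ ∀ h ∈ Ioc 0 h₀, ∀ p ∈ S,
      ‖iteratedFDeriv ℝ k (critVal φ (a h)) p‖ ≤ C := by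
  set s : Eu d × Eu d → ((Eu d × Eu d) × Eu d) × Eu d := fun p => ((p, p.2), crit φ (p, p.2))
    with hsdef
  have ss : ContDiff ℝ ∞ s := by
    have := contDiff_crit hφ
    fun_prop
  have hS' : IsCompact ((fun p : Eu d × Eu d => (p, p.2)) '' S) := hS.image (by fun_prop)
  obtain ⟨N, hN⟩ := ha.tempered.growth _ hS'
  obtain ⟨C, hC0, hC⟩ := exists_bound_comp (k := k) hN
  obtain ⟨R, hR⟩ := (hS.image_of_continuousOn (f := fun p => (s p).2)
    (ss.continuous.snd).continuousOn).isBounded.exists_norm_le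
  have hbd : ∀ i, ∃ M : ℝ, ∀ p ∈ S, ‖iteratedFDeriv ℝ i s p‖ ≤ M := by
    intro i
    obtain ⟨M, hM⟩ := (hS.image_of_continuousOn (ss.continuous_iteratedFDeriv (m := i)
      (by exact_mod_cast le_top)).continuousOn).isBounded.exists_norm_le
    exact ⟨M, fun p hp => hM _ (mem_image_of_mem _ hp)⟩
  choose M hM using hbd
  set D := 1 + ∑ i ∈ Finset.range (k + 1), |M i| with hD
  have hD0 : 1 ≤ D := le_add_of_nonneg_right (Finset.sum_nonneg fun i _ => abs_nonneg _)
  refine ⟨k.factorial * (C * (1 + |R|) ^ N) * D ^ k, by positivity, fun h hh p hp => ?_⟩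
  refine norm_iteratedFDeriv_comp_le (ha.smooth hh) ss (n := k) (by exact_mod_cast le_top) p
    (fun i hi => ?_) (fun i hi hik => ?_)
  · refine (hC i hi h hh (p, p.2) (mem_image_of_mem _ hp) _).trans ?_
    gcongr
    exact (hR _ (mem_image_of_mem _ hp)).trans (le_abs_self R)
  · refine (hM i p hp).trans ?_
    calc M i ≤ |M i| := le_abs_self _
      _ ≤ ∑ i ∈ Finset.range (k + 1), |M i| :=
        Finset.single_le_sum (f := fun i => |M i|) (fun i _ => abs_nonneg _)
          (Finset.mem_range.2 (by omega))
      _ ≤ D := by linarith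
      _ ≤ D ^ i := le_self_pow₀ hD0 (by omega)

theorem contDiff_critVal (hφ : ContDiff ℝ ∞ φ) {b : ((Eu d × Eu d) × Eu d) × Eu d → ℂ}
    (hb : ContDiff ℝ ∞ b) : ContDiff ℝ ∞ (critVal φ b) := by
  have := contDiff_crit hφ
  unfold critVal
  fun_prop

end Recursion

/-! ### Derivatives in `(y, ξ)` and uniform bounds -/

section ParameterDerivative

variable {d : ℕ} {φ : Eu d × Eu d → ℝ} {κ : Set (Eu d)} {h₀ h : ℝ}
  {a : ℝ → ((Eu d × Eu d) × Eu d) × Eu d → ℂ}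

theorem isTempered_relPhase (hφ : ContDiff ℝ ∞ φ) :
    IsTempered h₀ (fun _ (z : ((Eu d × Eu d) × Eu d) × Eu d) => ((relPhase φ z : ℝ) : ℂ)) := by
  have h1 : ContDiff ℝ ∞ (fun w : (Eu d × Eu d) × Eu d =>
      ((φ (w.1.1, w.2) - φ w.1 : ℝ) : ℂ)) :=
    Complex.ofRealCLM.contDiff.comp ((hφ.comp (by fun_prop)).sub (hφ.comp (by fun_prop)))
  have h2 : ∀ j : Fin d, ContDiff ℝ ∞ (fun w : (Eu d × Eu d) × Eu d =>
      (((w.2 - w.1.2) j : ℝ) : ℂ)) := fun j =>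
    Complex.ofRealCLM.contDiff.comp ((EuclideanSpace.proj (𝕜 := ℝ) j).contDiff.comp
      (contDiff_snd.sub (contDiff_snd.comp contDiff_fst)))
  have h3 := (IsTempered.base (h₀ := h₀) (E := Eu d) h1).add
    (IsTempered.sum Finset.univ fun j : Fin d => (IsTempered.base (h2 j)).mul
      (IsTempered.linear (Complex.ofRealCLM.comp (EuclideanSpace.proj (𝕜 := ℝ) j))))
  convert h3 using 3 with _ z
  simp only [relPhase, PiLp.inner_apply, Complex.ofReal_add, Complex.ofReal_sum]
  congr 1
  refine Finset.sum_congr rfl fun j _ => ?_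
  simp [mul_comm]

/-- The amplitude of the derivative of an oscillatory integral in the direction `v`,
up to the factor `h⁻¹`. -/
def dirAmp (φ : Eu d × Eu d → ℝ) (v : Eu d × Eu d)
    (a : ℝ → ((Eu d × Eu d) × Eu d) × Eu d → ℂ) (h : ℝ)
    (z : ((Eu d × Eu d) × Eu d) × Eu d) : ℂ :=
  (h : ℂ) * fderiv ℝ (a h) z ((v, 0), 0) +
    Complex.I * fderiv ℝ (fun z => ((relPhase φ z : ℝ) : ℂ)) z ((v, 0), 0) * a h z

/-- Differentiating the exponential brings down a derivative of the phase, which has polynomial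
growth in `x`; the class of amplitudes absorbs it. Taking `h⁻¹` out keeps the family bounded as `h`
tends to `0`. -/
theorem IsAmplitude.dirAmp (ha : IsAmplitude h₀ κ a) (hφ : ContDiff ℝ ∞ φ) (hκ : IsCompact κ)
    (v : Eu d × Eu d) : IsAmplitude h₀ κ (dirAmp φ v a) := by
  refine ((ha.fderiv_apply hκ ((v, 0), 0)).const_mul (c := fun h => (h : ℂ)) (R := h₀)
    fun h hh => ?_).add (ha.mul_left (((isTempered_relPhase hφ).fderiv_apply ((v, 0), 0)).const_mul
      (c := fun _ => Complex.I) (R := 1) (by simp)))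
  rw [Complex.norm_real, Real.norm_of_nonneg hh.1.le]
  exact hh.2

theorem contDiff_osc_relPhase_mul (hφ : ContDiff ℝ ∞ φ)
    {b : ((Eu d × Eu d) × Eu d) × Eu d → ℂ} (hb : ContDiff ℝ ∞ b) (h : ℝ) :
    ContDiff ℝ ∞ (fun z => osc h (relPhase φ z) * b z) :=
  ((contDiff_osc h).comp (contDiff_relPhase hφ)).mul hb

theorem fderiv_osc_relPhase_mul (hφ : ContDiff ℝ ∞ φ) (hb : ContDiff ℝ ∞ (a h)) (hh : h ≠ 0)
    (z : ((Eu d × Eu d) × Eu d) × Eu d) (v : Eu d × Eu d) :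
    fderiv ℝ (fun z => osc h (relPhase φ z) * a h z) z ((v, 0), 0) =
      (h : ℂ)⁻¹ * (osc h (relPhase φ z) * dirAmp φ v a h z) := by
  have h1 : DifferentiableAt ℝ (relPhase φ) z := (contDiff_relPhase hφ).differentiable (by simp) z
  have h2 : HasFDerivAt (fun z => ((relPhase φ z : ℝ) : ℂ))
      (Complex.ofRealCLM.comp (fderiv ℝ (relPhase φ) z)) z :=
    Complex.ofRealCLM.hasFDerivAt.comp z h1.hasFDerivAt
  have h3 := (hasDerivAt_osc h (relPhase φ z)).hasFDerivAt.comp z h1.hasFDerivAt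
  have h4 := h3.mul (hb.differentiable (by simp) z).hasFDerivAt
  have h5 : fderiv ℝ (fun z => osc h (relPhase φ z) * a h z) z = _ := h4.fderiv
  have hc : (h : ℂ) ≠ 0 := by exact_mod_cast hh
  rw [h5, dirAmp, h2.fderiv]
  simp
  field_simp

/-- Expresses a Fréchet derivative through finitely many directional ones, so that inductions on the
order of differentiation involve only scalar oscillatory integrals. -/
theorem exists_basis_clm (P : Type*) [NormedAddCommGroup P] [NormedSpace ℝ P]
    [FiniteDimensional ℝ P] : ∃ (n : ℕ) (b : Fin n → P) (l : Fin n → P →L[ℝ] ℝ),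
      ∀ L : P →L[ℝ] ℂ, L = ∑ i, (l i).smulRight (L (b i)) := by
  let B := Module.finBasis ℝ P
  refine ⟨_, B, fun i => LinearMap.toContinuousLinearMap (B.coord i), fun L => ?_⟩
  ext v
  conv_lhs => rw [← B.sum_repr v, map_sum]
  simp

theorem hasFDerivAt_etaInt (hφ : ContDiff ℝ ∞ φ) (hb : ContDiff ℝ ∞ (a h)) (hs : EtaSupp κ (a h))
    (hκ : IsCompact κ) (hh : h ≠ 0) (p : Eu d × Eu d) (x : Eu d) :
    ∃ L : Eu d × Eu d →L[ℝ] ℂ, HasFDerivAt (fun p => etaInt φ h (a h) p x) L p ∧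
      ∀ v, L v = (h : ℂ)⁻¹ * etaInt φ h (dirAmp φ v a h) p x := by
  set F : ((Eu d × Eu d) × Eu d) × Eu d → ℂ := fun z => osc h (relPhase φ z) * a h z with hF
  have sF : ContDiff ℝ ∞ F := contDiff_osc_relPhase_mul hφ hb h
  set ι : Eu d × Eu d →L[ℝ] ((Eu d × Eu d) × Eu d) × Eu d :=
    (ContinuousLinearMap.inl ℝ _ _).comp (ContinuousLinearMap.inl ℝ _ _) with hι
  set g : Eu d × (Eu d × Eu d) → ℂ := fun q => F ((q.2, q.1), x) with hg
  set g' : Eu d × (Eu d × Eu d) → (Eu d × Eu d →L[ℝ] ℂ) :=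
    fun q => (fderiv ℝ F ((q.2, q.1), x)).comp ι with hg'
  have cg' : Continuous g' := by
    have := sF.continuous_fderiv (by simp)
    exact (this.comp (f := fun q : Eu d × (Eu d × Eu d) => ((q.2, q.1), x))
      (by fun_prop)).clm_comp continuous_const
  have hd : ∀ η p, HasFDerivAt (fun p => g (η, p)) (g' (η, p)) p := by
    intro η p
    have h1 : HasFDerivAt (fun p : Eu d × Eu d => ((p, η), x)) ι p :=
      HasFDerivAt.comp (g := fun w => (w, x)) (f := fun p => (p, η)) p
        (hasFDerivAt_prodMk_left (p, η) x) (hasFDerivAt_prodMk_left p η)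
    exact (sF.differentiable (by simp) _).hasFDerivAt.comp p h1
  have cg : Continuous g := by
    have := sF.continuous
    fun_prop
  have h1 := hasFDerivAt_setIntegral_of_continuous (μ := volume) hκ cg cg' hd p
  refine ⟨∫ η in κ, g' (η, p), ?_, fun v => ?_⟩
  · simp_rw [etaInt_eq_setIntegral hs]
    exact h1
  · have h2 : EtaSupp κ (dirAmp φ v a h) :=
      ((hs.fderiv_apply hκ _).mul_left _).add (hs.mul_left _)
    rw [ContinuousLinearMap.integral_apply, etaInt_eq_setIntegral h2, ← integral_const_mul]
    · congr 1
      ext η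
      exact fderiv_osc_relPhase_mul hφ hb hh ((p, η), x) v
    · have := cg'.comp (f := fun η : Eu d => (η, p)) (by fun_prop)
      exact this.continuousOn.integrableOn_compact hκ

theorem IsAmplitude.hasFDerivAt_oscInt (ha : IsAmplitude h₀ κ a) (hφ : ContDiff ℝ ∞ φ)
    (hκ : IsCompact κ) (hh : h ∈ Ioc 0 h₀) {n : ℕ} {b : Fin n → Eu d × Eu d}
    {l : Fin n → Eu d × Eu d →L[ℝ] ℝ}
    (hl : ∀ L : Eu d × Eu d →L[ℝ] ℂ, L = ∑ i, (l i).smulRight (L (b i))) (p : Eu d × Eu d) :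
    HasFDerivAt (oscInt φ h (a h))
      (∑ i, (l i).smulRight ((h : ℂ)⁻¹ * oscInt φ h (TiltedFIO.dirAmp φ (b i) a h) p)) p := by
  have hb := fun i => ha.dirAmp hφ hκ (b i)
  set F' : Eu d × Eu d → Eu d → (Eu d × Eu d →L[ℝ] ℂ) := fun p x =>
    ∑ i, (l i).smulRight ((h : ℂ)⁻¹ * etaInt φ h (TiltedFIO.dirAmp φ (b i) a h) p x) with hF'
  have hder : ∀ p x, HasFDerivAt (fun p => etaInt φ h (a h) p x) (F' p x) p := by
    intro p x
    obtain ⟨L, hL, hLv⟩ := hasFDerivAt_etaInt hφ (ha.smooth hh) (ha.supp h hh) hκ hh.1.ne' p x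
    have e : L = F' p x := by
      rw [hl L, hF']
      simp_rw [hLv]
    rwa [← e]
  have cF' : ∀ p, Continuous (F' p) := fun p => by
    refine continuous_finsetSum _ fun i _ => ?_
    exact ((ContinuousLinearMap.smulRightL ℝ (Eu d × Eu d) ℂ (l i)).continuous).comp
      (continuous_const.mul ((hb i).continuous_etaInt hφ hκ hh p))
  choose C hC0 hC using fun i => (hb i).etaInt_bound hφ hκ (isCompact_closedBall p 1)
  have h1 := hasFDerivAt_integral_of_dominated_of_fderiv_le (μ := volume)
    (s := Metric.closedBall p 1)
    (F := fun p x => etaInt φ h (a h) p x) (F' := F')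
    (bound := fun x => ∑ i, ‖l i‖ * (h⁻¹ * (C i * ((1 + ‖x‖) ^ (d + 1))⁻¹)))
    (x₀ := p) (Metric.closedBall_mem_nhds p one_pos)
    (Filter.Eventually.of_forall fun p =>
      (ha.continuous_etaInt hφ hκ hh p).aestronglyMeasurable)
    (ha.integrable_etaInt hφ hκ hh p) (cF' p).aestronglyMeasurable
    (Filter.Eventually.of_forall fun x q hq => ?_)
    (integrable_finsetSum _ fun i _ =>
      ((integrable_inv_one_add_norm_pow.const_mul _).const_mul _).const_mul _)
    (Filter.Eventually.of_forall fun x q _ => hder q x)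
  · have h2 := h1.const_mul ((((2 * Real.pi * h) ^ d)⁻¹ : ℝ) : ℂ)
    refine h2.congr_fderiv ?_
    have hi : ∀ i, Integrable (fun x =>
        (l i).smulRight ((h : ℂ)⁻¹ * etaInt φ h (TiltedFIO.dirAmp φ (b i) a h) p x)) := fun i =>
      (ContinuousLinearMap.smulRightL ℝ (Eu d × Eu d) ℂ (l i)).integrable_comp
        (((hb i).integrable_etaInt hφ hκ hh p).const_mul _)
    rw [hF', integral_finsetSum _ fun i _ => hi i, Finset.smul_sum]
    refine Finset.sum_congr rfl fun i _ => ?_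
    have h3 := (ContinuousLinearMap.smulRightL ℝ (Eu d × Eu d) ℂ (l i)).integral_comp_comm
      (((hb i).integrable_etaInt hφ hκ hh p).const_mul ((h : ℂ)⁻¹))
    change ∫ x, (l i).smulRight ((h : ℂ)⁻¹ * etaInt φ h (TiltedFIO.dirAmp φ (b i) a h) p x) =
      (l i).smulRight (∫ x, (h : ℂ)⁻¹ * etaInt φ h (TiltedFIO.dirAmp φ (b i) a h) p x) at h3
    rw [h3, integral_const_mul]
    refine ContinuousLinearMap.ext fun v => ?_
    simp [oscInt]
    ring
  · refine (norm_sum_le _ _).trans (Finset.sum_le_sum fun i _ => ?_)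
    rw [ContinuousLinearMap.norm_smulRight_apply, norm_mul, norm_inv, Complex.norm_real,
      Real.norm_of_nonneg hh.1.le]
    have := inv_nonneg.2 hh.1.le
    gcongr
    exact hC i h hh q hq x

theorem IsAmplitude.contDiff_oscInt (ha : IsAmplitude h₀ κ a) (hφ : ContDiff ℝ ∞ φ)
    (hκ : IsCompact κ) (hh : h ∈ Ioc 0 h₀) : ContDiff ℝ ∞ (oscInt φ h (a h)) := by
  obtain ⟨n, b, l, hl⟩ := exists_basis_clm (Eu d × Eu d)
  refine contDiff_infty.2 fun k => ?_
  induction k generalizing a with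
  | zero =>
    refine contDiff_zero.2 (continuous_iff_continuousAt.2 fun p => ?_)
    exact (ha.hasFDerivAt_oscInt hφ hκ hh hl p).continuousAt
  | succ k ih =>
    have hder := fun p => ha.hasFDerivAt_oscInt hφ hκ hh hl p
    rw [Nat.cast_succ]
    refine contDiff_succ_iff_fderiv.2 ⟨fun p => (hder p).differentiableAt, by simp, ?_⟩
    rw [funext fun p => (hder p).fderiv]
    refine ContDiff.sum fun i _ => ?_
    exact (ContinuousLinearMap.smulRightL ℝ (Eu d × Eu d) ℂ (l i)).contDiff.comp
      (contDiff_const.mul (ih (ha.dirAmp hφ hκ (b i))))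

theorem exists_norm_iteratedFDeriv_clm_comp_le {P H : Type*} [NormedAddCommGroup P]
    [NormedSpace ℝ P] [NormedAddCommGroup H] [NormedSpace ℝ H] (Λ : ℂ →L[ℝ] H) (k : ℕ) :
    ∃ D : ℝ, 0 ≤ D ∧ ∀ g : P → ℂ, ContDiff ℝ k g → ∀ p,
      ‖iteratedFDeriv ℝ k (Λ ∘ g) p‖ ≤ D * ‖iteratedFDeriv ℝ k g p‖ :=
  ⟨‖Λ‖, norm_nonneg _, fun _ hg _ => Λ.norm_iteratedFDeriv_comp_left hg.contDiffAt le_rfl⟩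

/-- The crude bound: the prefactor costs `h⁻¹ ^ d`, and each derivative costs one more `h⁻¹` through
`dirAmp`. -/
theorem IsAmplitude.iteratedFDeriv_oscInt_bound_pow (ha : IsAmplitude h₀ κ a)
    (hφ : ContDiff ℝ ∞ φ) (hκ : IsCompact κ) {S : Set (Eu d × Eu d)} (hS : IsCompact S) (k : ℕ) :
    ∃ C : ℝ, 0 ≤ C ∧ ∀ h ∈ Ioc 0 h₀, ∀ p ∈ S,
      ‖iteratedFDeriv ℝ k (oscInt φ h (a h)) p‖ ≤ C * h⁻¹ ^ (d + k) := by
  obtain ⟨n, b, l, hl⟩ := exists_basis_clm (Eu d × Eu d)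
  induction k generalizing a with
  | zero => simpa using ha.oscInt_bound hφ hκ hS
  | succ k ih =>
    choose C hC0 hC using fun i => ih (ha.dirAmp hφ hκ (b i))
    set Λ := fun i => ContinuousLinearMap.smulRightL ℝ (Eu d × Eu d) ℂ (l i) with hΛ
    choose D hD0 hD using fun i =>
      exists_norm_iteratedFDeriv_clm_comp_le (P := Eu d × Eu d) (Λ i) k
    refine ⟨∑ i, D i * C i, Finset.sum_nonneg fun i _ => mul_nonneg (hD0 i) (hC0 i),
      fun h hh p hp => ?_⟩
    have hder := fun p => ha.hasFDerivAt_oscInt hφ hκ hh hl p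
    have sJ := fun i => ((ha.dirAmp hφ hκ (b i)).contDiff_oscInt hφ hκ hh).of_le
      (show (k : ℕ∞ω) ≤ ∞ by exact_mod_cast le_top)
    have e : fderiv ℝ (oscInt φ h (a h)) = fun p => ∑ i,
        (Λ i ∘ ((h : ℂ)⁻¹ • oscInt φ h (TiltedFIO.dirAmp φ (b i) a h))) p :=
      funext fun p => (hder p).fderiv
    have sJ' : ∀ i, ContDiff ℝ k ((h : ℂ)⁻¹ • oscInt φ h (TiltedFIO.dirAmp φ (b i) a h)) :=
      fun i => contDiff_const.mul (sJ i)
    rw [← norm_iteratedFDeriv_fderiv, e, iteratedFDeriv_fun_sum_apply, Finset.sum_mul]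
    · refine (norm_sum_le _ _).trans (Finset.sum_le_sum fun i _ => ?_)
      refine (hD i _ (sJ' i) p).trans ?_
      rw [mul_assoc]
      refine mul_le_mul_of_nonneg_left ?_ (hD0 i)
      rw [iteratedFDeriv_const_smul_apply (sJ i).contDiffAt, norm_smul, norm_inv,
        Complex.norm_real, Real.norm_of_nonneg hh.1.le]
      calc h⁻¹ * ‖iteratedFDeriv ℝ k (oscInt φ h (TiltedFIO.dirAmp φ (b i) a h)) p‖
          ≤ h⁻¹ * (C i * h⁻¹ ^ (d + k)) := by
            have := inv_nonneg.2 hh.1.le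
            gcongr
            exact hC i h hh p hp
        _ = _ := by ring
    · exact fun i _ => ((Λ i).contDiff.comp (sJ' i)).contDiffAt

/-- Oscillatory integrals are bounded in the `C^∞` topology, uniformly in `h ∈ (0, h₀]`. -/
theorem IsAmplitude.iteratedFDeriv_oscInt_bound (ha : IsAmplitude h₀ κ a)
    (hφ : ContDiff ℝ ∞ φ) (hκ : IsCompact κ) {S : Set (Eu d × Eu d)} (hS : IsCompact S) (k : ℕ) :
    ∃ C : ℝ, 0 ≤ C ∧ ∀ h ∈ Ioc 0 h₀, ∀ p ∈ S,
      ‖iteratedFDeriv ℝ k (oscInt φ h (a h)) p‖ ≤ C := by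
  -- Bootstrap on the loss `m`, starting from the crude `m = d + k`. The expansion puts a factor `h`
  -- before the integral of `nextAmp`, so a loss of `m + 1` for every amplitude gives a loss of `m`
  -- for every amplitude.
  have key : ∀ m j : ℕ, m + j = d + k → ∀ a : ℝ → ((Eu d × Eu d) × Eu d) × Eu d → ℂ,
      IsAmplitude h₀ κ a → ∃ C : ℝ, 0 ≤ C ∧ ∀ h ∈ Ioc 0 h₀, ∀ p ∈ S,
        ‖iteratedFDeriv ℝ k (oscInt φ h (a h)) p‖ ≤ C * h⁻¹ ^ m := by
    intro m j
    induction j generalizing m with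
    | zero =>
      rintro rfl a ha
      exact ha.iteratedFDeriv_oscInt_bound_pow hφ hκ hS k
    | succ j ih =>
      intro hm a ha
      obtain ⟨C, hC0, hC⟩ := ih (m + 1) (by omega) _ (ha.nextAmp hφ hκ)
      obtain ⟨D, hD0, hD⟩ := ha.critVal_bound hφ hS k
      -- The critical value is bounded by `D`, and `1 ≤ |h₀| ^ m * h⁻¹ ^ m` because `h ≤ h₀`.
      refine ⟨D * |h₀| ^ m + C, by positivity, fun h hh p hp => ?_⟩
      have e : oscInt φ h (a h) = critVal φ (a h) +
          (Complex.I * (h : ℂ)) • oscInt φ h (TiltedFIO.nextAmp φ a h) :=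
        funext fun p => ha.oscInt_eq hφ hκ hh p
      have s1 : ContDiff ℝ k (critVal φ (a h)) :=
        (contDiff_critVal hφ (ha.smooth hh)).of_le (by exact_mod_cast le_top)
      have s2 : ContDiff ℝ k (oscInt φ h (TiltedFIO.nextAmp φ a h)) :=
        ((ha.nextAmp hφ hκ).contDiff_oscInt hφ hκ hh).of_le (by exact_mod_cast le_top)
      have s3 : ContDiff ℝ k ((Complex.I * (h : ℂ)) • oscInt φ h (TiltedFIO.nextAmp φ a h)) :=
        contDiff_const.mul s2
      have h0 : 0 < h := hh.1
      rw [e, iteratedFDeriv_add_apply s1.contDiffAt s3.contDiffAt,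
        iteratedFDeriv_const_smul_apply s2.contDiffAt]
      refine (norm_add_le _ _).trans ?_
      rw [add_mul]
      refine add_le_add ((hD h hh p hp).trans ?_) ?_
      · rw [mul_assoc, ← mul_pow]
        refine le_mul_of_one_le_right hD0 (one_le_pow₀ ?_)
        rw [← div_eq_mul_inv, one_le_div h0]
        exact hh.2.trans (le_abs_self _)
      · rw [norm_smul, norm_mul, Complex.norm_I, one_mul, Complex.norm_real,
          Real.norm_of_nonneg h0.le]
        calc h * ‖iteratedFDeriv ℝ k (oscInt φ h (TiltedFIO.nextAmp φ a h)) p‖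
            ≤ h * (C * h⁻¹ ^ (m + 1)) := by
              gcongr
              exact hC h hh p hp
          _ = C * h⁻¹ ^ m * (h * h⁻¹) := by ring
          _ = C * h⁻¹ ^ m := by rw [mul_inv_cancel₀ h0.ne', mul_one]
  simpa using key 0 (d + k) (by omega) a ha

end ParameterDerivative

/-! ### The phase of the propagator and its smooth extension -/

section Phase

variable {d : ℕ}

theorem one_sub_norm_sq_pos {ξ : Eu d} (hξ : ξ ∈ Metric.ball (0 : Eu d) 1) : 0 < 1 - ‖ξ‖ ^ 2 := by
  rw [mem_ball_zero_iff] at hξ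
  nlinarith [norm_nonneg ξ]

theorem fHeight_pos {ξ : Eu d} (hξ : ξ ∈ Metric.ball (0 : Eu d) 1) : 0 < fHeight ξ :=
  Real.sqrt_pos.2 (one_sub_norm_sq_pos hξ)

theorem contDiffAt_fHeight {ξ : Eu d} (hξ : ξ ∈ Metric.ball (0 : Eu d) 1) :
    ContDiffAt ℝ ∞ fHeight ξ :=
  (contDiffAt_const.sub (contDiff_norm_sq ℝ).contDiffAt).sqrt (one_sub_norm_sq_pos hξ).ne'

theorem hasFDerivAt_fHeight {ξ : Eu d} (hξ : ξ ∈ Metric.ball (0 : Eu d) 1) :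
    HasFDerivAt fHeight (-(fHeight ξ)⁻¹ • innerSL ℝ ξ) ξ := by
  have h1 : HasFDerivAt (fun ξ : Eu d => 1 - ‖ξ‖ ^ 2) (-(2 • innerSL ℝ ξ)) ξ := by
    have := (hasStrictFDerivAt_norm_sq ξ).hasFDerivAt
    exact this.const_sub 1
  have h2 := h1.sqrt (one_sub_norm_sq_pos hξ).ne'
  refine h2.congr_fderiv ?_
  have h3 := fHeight_pos hξ
  refine ContinuousLinearMap.ext fun v => ?_
  simp only [fHeight] at h3 ⊢
  simp
  field_simp

/-- The square root is singular on the unit sphere. A bump function equal to `1` near `κ` and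
supported inside the open ball removes the singularity while keeping all derivatives near `κ`. -/
theorem exists_smooth_height {κ : Set (Eu d)} (hκ : IsCompact κ)
    (hb : κ ⊆ Metric.ball 0 1) : ∃ F : Eu d → ℝ, ContDiff ℝ ∞ F ∧ ∃ U : Set (Eu d), IsOpen U ∧
      κ ⊆ U ∧ U ⊆ Metric.ball 0 1 ∧ ∀ η ∈ U, F η = fHeight η := by
  obtain ⟨r, hr, hκr⟩ := exists_pos_lt_subset_ball one_pos hκ.isClosed hb
  let B : ContDiffBump (0 : Eu d) := ⟨r, (1 + r) / 2, hr.1, by linarith [hr.2]⟩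
  refine ⟨fun η => B η * fHeight η, ?_, Metric.ball 0 r, Metric.isOpen_ball, hκr,
    Metric.ball_subset_ball hr.2.le, fun η hη => ?_⟩
  · refine contDiff_iff_contDiffAt.2 fun η => ?_
    by_cases hη : η ∈ Metric.ball (0 : Eu d) 1
    · exact B.contDiffAt.mul (contDiffAt_fHeight hη)
    · have h1 : η ∉ tsupport B := by
        rw [B.tsupport_eq]
        intro h2
        refine hη (Metric.closedBall_subset_ball ?_ h2)
        change (1 + r) / 2 < 1
        linarith [hr.2]
      have h2 : (fun η => B η * fHeight η) =ᶠ[nhds η] fun _ => 0 := by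
        filter_upwards [notMem_tsupport_iff_eventuallyEq.1 h1] with x hx
        simp [hx]
      exact contDiffAt_const.congr_of_eventuallyEq h2
  · change B η * fHeight η = fHeight η
    rw [B.one_of_mem_closedBall (Metric.ball_subset_closedBall hη), one_mul]

/-- The linear part of `g`. -/
def gLin (G : GLd d) : Eu d →L[ℝ] Eu d :=
  LinearMap.toContinuousLinearMap
    { toFun := fun η => piTransp G (Fin.cons 0 (fun j => η j))
      map_add' := fun η η' => by
        ext i
        simp [piTransp, Fin.tail, Matrix.mulVec, dotProduct, Fin.sum_univ_succ, mul_add,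
          Finset.sum_add_distrib]
      map_smul' := fun c η => by
        ext i
        simp [piTransp, Fin.tail, Matrix.mulVec, dotProduct, Fin.sum_univ_succ, Finset.mul_sum]
        exact Finset.sum_congr rfl fun j _ => by ring }

theorem gMap_eq (G : GLd d) (ξ : Eu d) :
    gMap G ξ = fHeight ξ • piTransp G (Pi.single 0 1) + gLin G ξ := by
  ext i
  simp [gMap, gLin, sigma, piTransp, Fin.tail, Matrix.mulVec, dotProduct, Fin.sum_univ_succ]
  ring

theorem xTilde_apply (G : GLd d) (y ξ : Eu d) (j : Fin d) :
    xTilde G y ξ j = -inner ℝ y (fderiv ℝ (gMap G) ξ (ev j)) := by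
  have h1 : ∀ v : Eu d, v j = inner ℝ v (ev j) := fun v => by
    simp [EuclideanSpace.inner_single_right]
  rw [h1, xTilde, inner_neg_left, ContinuousLinearMap.adjoint_inner_left]

/-- A smooth extension of the phase beyond a neighbourhood of a compact subset of the unit ball. -/
theorem exists_smooth_phase (G : GLd d) {κ : Set (Eu d)} (hκ : IsCompact κ)
    (hb : κ ⊆ Metric.ball 0 1) : ∃ φ : Eu d × Eu d → ℝ, ContDiff ℝ ∞ φ ∧
      ∃ U : Set (Eu d), IsOpen U ∧ κ ⊆ U ∧ U ⊆ Metric.ball 0 1 ∧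
        (∀ y, ∀ η ∈ U, φ (y, η) = phase G y η) ∧
        (∀ p : Eu d × Eu d, ∀ η ∈ U, crit φ (p, η) = xTilde G p.1 η) ∧
        ∀ p : Eu d × Eu d, ∀ η ∈ U, ∀ j, fderiv ℝ (crit φ) (p, η) (0, ev j) =
          alpha G p.1 • ((fHeight η)⁻¹ • ev j + (η j / fHeight η ^ 3) • η) := by
  obtain ⟨F, sF, U, hU, hκU, hUb, hF⟩ := exists_smooth_height hκ hb
  set b := piTransp G (Pi.single 0 1) with hbdef
  set φ : Eu d × Eu d → ℝ := fun q => inner ℝ q.1 (F q.2 • b + gLin G q.2) with hφ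
  have sφ : ContDiff ℝ ∞ φ := by
    have := (gLin G).contDiff (n := ∞)
    exact contDiff_fst.inner ℝ (((sF.comp contDiff_snd).smul contDiff_const).add
      (this.comp contDiff_snd))
  have hder : ∀ y, ∀ η ∈ U, ∀ v, fderiv ℝ φ (y, η) (0, v) =
      -(alpha G y * ((fHeight η)⁻¹ * inner ℝ η v)) + inner ℝ y (gLin G v) := by
    intro y η hη v
    have e1 : F =ᶠ[nhds η] fHeight := by
      filter_upwards [hU.mem_nhds hη] with x hx using hF x hx
    have h1 := (hasFDerivAt_fHeight (hUb hη)).congr_of_eventuallyEq e1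
    have h2 : HasFDerivAt (fun η => F η • b + gLin G η) _ η :=
      (h1.smul_const b).fun_add (gLin G).hasFDerivAt
    have h3 := ((innerSL ℝ y).hasFDerivAt (x := F η • b + gLin G η)).comp η h2
    have h4 : HasFDerivAt (fun η => φ (y, η)) ((fderiv ℝ φ (y, η)).comp
        (ContinuousLinearMap.inr ℝ (Eu d) (Eu d))) η :=
      ((sφ.differentiable (by simp)) _).hasFDerivAt.comp η (hasFDerivAt_prodMk_right y η)
    have h5 := congrArg (fun L => L v) (h4.unique h3)
    simp only [ContinuousLinearMap.comp_apply, ContinuousLinearMap.inr_apply] at h5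
    rw [h5]
    simp [inner_add_right, inner_smul_right, alpha, hbdef]
    ring
  have hg : ∀ y, ∀ η ∈ U, ∀ v, inner ℝ y (fderiv ℝ (gMap G) η v) =
      -(alpha G y * ((fHeight η)⁻¹ * inner ℝ η v)) + inner ℝ y (gLin G v) := by
    intro y η hη v
    have h2 : HasFDerivAt (fun η => fHeight η • b + gLin G η) _ η :=
      ((hasFDerivAt_fHeight (hUb hη)).smul_const b).fun_add (gLin G).hasFDerivAt
    rw [← funext (gMap_eq G)] at h2
    rw [h2.fderiv]
    simp [inner_add_right, inner_smul_right, alpha, hbdef]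
    ring
  refine ⟨φ, sφ, U, hU, hκU, hUb, fun y η hη => ?_, fun p η hη => ?_, fun p η hη j => ?_⟩
  · rw [phase, gMap_eq, hφ]
    simp only [hF η hη]
    rfl
  · ext j
    rw [xTilde_apply, hg _ η hη]
    change -fderiv ℝ φ (p.1, η) (0, ev j) = _
    rw [hder _ η hη]
  -- On `U` the critical point is `(α / f(η)) η - c₀`. The linear part of `g` contributes only the
  -- constant `c₀`, so the derivative comes from `η / f(η)` alone; the `f⁻³` term arises from
  -- differentiating `1 / f`.
  · set c₀ : Eu d := WithLp.toLp 2 fun j => inner ℝ p.1 (gLin G (ev j)) with hc₀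
    have e1 : (fun η => crit φ (p, η)) =ᶠ[nhds η]
        fun η => (alpha G p.1 * (fHeight η)⁻¹) • η - c₀ := by
      filter_upwards [hU.mem_nhds hη] with x hx
      ext k
      change -fderiv ℝ φ (p.1, x) (0, ev k) = _
      rw [hder _ x hx]
      simp [hc₀, EuclideanSpace.inner_single_right]
      ring
    have hpos := fHeight_pos (hUb hη)
    have h1 := ((((hasDerivAt_inv hpos.ne').hasFDerivAt.comp η
      (hasFDerivAt_fHeight (hUb hη))).const_mul (alpha G p.1)).smul (hasFDerivAt_id η)).sub_const c₀
    have h2 := HasFDerivAt.congr_of_eventuallyEq h1 e1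
    have h4 : HasFDerivAt (fun η => crit φ (p, η)) ((fderiv ℝ (crit φ) (p, η)).comp
        (ContinuousLinearMap.inr ℝ (Eu d × Eu d) (Eu d))) η :=
      (((contDiff_crit sφ).differentiable (by simp)) _).hasFDerivAt.comp η
        (hasFDerivAt_prodMk_right p η)
    have h5 := congrArg (fun L => L (ev j)) (h4.unique h2)
    simp only [ContinuousLinearMap.comp_apply, ContinuousLinearMap.inr_apply] at h5
    rw [h5]
    ext k
    simp [EuclideanSpace.inner_single_right]
    field_simp

end Phase

/-! ### The subprincipal term -/

section SecondOrder

variable {d : ℕ}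

/-- The linear map `(((y, ξ), η), x) ↦ ((η + ξ) / 2, x)`. -/
def midMap (d : ℕ) : ((Eu d × Eu d) × Eu d) × Eu d →L[ℝ] Eu d × Eu d :=
  (((2⁻¹ : ℝ) • (ContinuousLinearMap.snd ℝ (Eu d × Eu d) (Eu d) +
    (ContinuousLinearMap.snd ℝ (Eu d) (Eu d)).comp
      (ContinuousLinearMap.fst ℝ (Eu d × Eu d) (Eu d)))).comp
    (ContinuousLinearMap.fst ℝ ((Eu d × Eu d) × Eu d) (Eu d))).prod
    (ContinuousLinearMap.snd ℝ ((Eu d × Eu d) × Eu d) (Eu d))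

theorem midMap_apply (z : ((Eu d × Eu d) × Eu d) × Eu d) :
    midMap d z = ((2⁻¹ : ℝ) • (z.1.2 + z.1.1.2), z.2) := rfl

variable {q : Eu d × Eu d → ℂ}

theorem mixedDiv_eq (hq : ContDiff ℝ ∞ q) (ξ x : Eu d) :
    mixedDiv q ξ x = ∑ j, fderiv ℝ (fderiv ℝ q) (ξ, x) (ev j, 0) (0, ev j) := by
  refine Finset.sum_congr rfl fun j _ => ?_
  rw [iteratedFDeriv_two_apply]
  have h1 : IsSymmSndFDerivAt ℝ q (ξ, x) := hq.contDiffAt.isSymmSndFDerivAt (by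
    rw [minSmoothness_of_isRCLikeNormedField]
    exact WithTop.coe_le_coe.2 (le_top (a := (2 : ℕ∞))))
  exact h1.eq _ _

theorem iteratedFDeriv_two_snd (hq : ContDiff ℝ ∞ q) (ξ x u v : Eu d) :
    iteratedFDeriv ℝ 2 (fun x' => q (ξ, x')) x ![u, v] =
      fderiv ℝ (fderiv ℝ q) (ξ, x) (0, u) (0, v) := by
  rw [iteratedFDeriv_prodMk_left hq, ContinuousMultilinearMap.compContinuousLinearMap_apply,
    iteratedFDeriv_two_apply]
  rfl

theorem laplX_eq (hq : ContDiff ℝ ∞ q) (ξ x : Eu d) :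
    laplX q ξ x = ∑ j, fderiv ℝ (fderiv ℝ q) (ξ, x) (0, ev j) (0, ev j) := by
  rw [laplX, InnerProductSpace.laplacian_eq_iteratedFDeriv_orthonormalBasis _
    (EuclideanSpace.basisFun (Fin d) ℝ)]
  refine Finset.sum_congr rfl fun j _ => ?_
  rw [iteratedFDeriv_two_snd hq]
  simp

theorem radialSq_eq (hq : ContDiff ℝ ∞ q) (ξ x : Eu d) :
    radialSq q ξ x = ∑ j, (ξ j : ℂ) * fderiv ℝ (fderiv ℝ q) (ξ, x) (0, ξ) (0, ev j) := by
  rw [radialSq, iteratedFDeriv_two_snd hq]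
  have h1 : ((0 : Eu d), ξ) = ∑ j, ξ j • ((0 : Eu d), ev j) := by
    refine Prod.ext ?_ ?_
    · simp [Prod.fst_sum]
    · simpa [Prod.snd_sum] using eq_sum_ev ξ
  rw [congrArg (fderiv ℝ (fderiv ℝ q) (ξ, x) (0, ξ)) h1, map_sum]
  simp only [map_smul, Complex.real_smul]

/-- The subprincipal term: the value at the critical point of the first order amplitude. -/
theorem critVal_nextAmp {φ : Eu d × Eu d → ℝ} (hφ : ContDiff ℝ ∞ φ) {χ : Eu d → ℝ}
    (hχ : ContDiff ℝ ∞ χ) (hq : ContDiff ℝ ∞ q) {A f : ℝ} {p : Eu d × Eu d} {x : Eu d}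
    (hp : p.2 ∈ interior {ξ | χ ξ = 1}) (hx : crit φ (p, p.2) = x)
    (hd : ∀ j, fderiv ℝ (crit φ) (p, p.2) (0, ev j) =
      A • (f⁻¹ • ev j + (p.2 j / f ^ 3) • p.2)) (h : ℝ) :
    critVal φ (nextAmp φ (fun _ z => (χ z.1.2 : ℂ) * q (midMap d z)) h) p =
      2⁻¹ * (mixedDiv q p.2 x + (A : ℂ) * laplX q p.2 x / (f : ℂ)
        + (A : ℂ) / (f : ℂ) ^ 3 * radialSq q p.2 x) := by
  set a : ℝ → ((Eu d × Eu d) × Eu d) × Eu d → ℂ :=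
    fun _ z => (χ z.1.2 : ℂ) * q (midMap d z) with ha
  have sa : ContDiff ℝ ∞ (a h) :=
    (Complex.ofRealCLM.contDiff.comp (hχ.comp (by fun_prop))).mul (hq.comp (midMap d).contDiff)
  have hdq := hq.differentiable (by simp)
  have hd2q : Differentiable ℝ (fderiv ℝ q) :=
    (hq.fderiv_right (m := ∞) (by simp)).differentiable (by simp)
  have hmid : midMap d ((p, p.2), x) = (p.2, x) := by
    rw [midMap_apply]
    refine Prod.ext ?_ rfl
    change (2⁻¹ : ℝ) • (p.2 + p.2) = p.2
    rw [← two_smul ℝ, smul_smul]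
    norm_num
  have hO : IsOpen {z : ((Eu d × Eu d) × Eu d) × Eu d | z.1.2 ∈ interior {ξ | χ ξ = 1}} :=
    isOpen_interior.preimage (by fun_prop)
  -- The cut-off is constant near `η = ξ`, so it contributes to no derivative there.
  have e1 : ∀ z ∈ {z : ((Eu d × Eu d) × Eu d) × Eu d | z.1.2 ∈ interior {ξ | χ ξ = 1}},
      ∀ v, fderiv ℝ (a h) z v = fderiv ℝ q (midMap d z) (midMap d v) := by
    intro z hz v
    have h1 : a h =ᶠ[nhds z] fun z => q (midMap d z) := by
      filter_upwards [hO.mem_nhds hz] with z' hz'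
      have h2 : χ z'.1.2 = 1 :=
        (interior_subset : interior {ξ | χ ξ = 1} ⊆ {ξ | χ ξ = 1}) hz'
      simp [ha, h2]
    rw [h1.fderiv_eq]
    have h3 := (hdq (midMap d z)).hasFDerivAt.comp z (midMap d).hasFDerivAt
    have h4 : fderiv ℝ (fun z => q (midMap d z)) z = _ := h3.fderiv
    rw [h4]
    rfl
  have e2 : ∀ u v, fderiv ℝ (fun z => fderiv ℝ (a h) z v) ((p, p.2), x) u =
      fderiv ℝ (fderiv ℝ q) (p.2, x) (midMap d u) (midMap d v) := by
    intro u v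
    have h2 : {z : ((Eu d × Eu d) × Eu d) × Eu d | z.1.2 ∈ interior {ξ | χ ξ = 1}} ∈
        nhds ((p, p.2), x) := hO.mem_nhds hp
    have h1 : (fun z => fderiv ℝ (a h) z v) =ᶠ[nhds ((p, p.2), x)]
        fun z => fderiv ℝ q (midMap d z) (midMap d v) := by
      filter_upwards [h2] with z hz using e1 z hz v
    rw [h1.fderiv_eq]
    have h3 := (hd2q (midMap d ((p, p.2), x))).hasFDerivAt.comp ((p, p.2), x)
      (midMap d).hasFDerivAt
    have h4 := h3.clm_apply (hasFDerivAt_const (midMap d v) ((p, p.2), x))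
    have h5 : fderiv ℝ (fun z => fderiv ℝ q (midMap d z) (midMap d v)) ((p, p.2), x) = _ :=
      h4.fderiv
    rw [h5, hmid]
    simp
  -- The two factors `1 / 2` have different origins: the Weyl midpoint `(η + ξ) / 2` in the mixed
  -- term, and the average in `fderiv_avg_center` in the terms from the motion of the critical
  -- point.
  have e3 : ∀ j, fderiv ℝ (avg (crit φ) (fun h z => fderiv ℝ (a h) z (0, ev j)) h)
      ((p, p.2), x) ((0, ev j), 0) =
      2⁻¹ * fderiv ℝ (fderiv ℝ q) (p.2, x) (ev j, 0) (0, ev j) +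
      2⁻¹ * ((A : ℂ) / f * fderiv ℝ (fderiv ℝ q) (p.2, x) (0, ev j) (0, ev j) +
        (A : ℂ) / f ^ 3 * ((p.2 j : ℂ) *
          fderiv ℝ (fderiv ℝ q) (p.2, x) (0, p.2) (0, ev j))) := by
    intro j
    have h1 := fderiv_avg_center (contDiff_crit hφ) (h := h)
      (a := fun h z => fderiv ℝ (a h) z (0, ev j))
      ((sa.fderiv_right (m := ∞) (by simp)).clm_apply contDiff_const) (p, p.2) (0, ev j)
    rw [hx] at h1
    rw [h1, e2, e2, hd]
    have m1 : midMap d ((0, ev j), 0) = (2⁻¹ : ℝ) • (ev j, 0) := by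
      rw [midMap_apply]; simp
    have m2 : midMap d (0, ev j) = (0, ev j) := by
      rw [midMap_apply]; simp
    have m3 : midMap d (0, A • (f⁻¹ • ev j + (p.2 j / f ^ 3) • p.2)) =
        (A / f) • (0, ev j) + (A / f ^ 3 * p.2 j) • (0, p.2) := by
      rw [midMap_apply]
      refine Prod.ext (by simp) ?_
      simp [smul_smul]
      congr 2
      ring
    rw [m1, m2, m3]
    simp only [map_smul, map_add, add_apply, smul_apply, Complex.real_smul]
    push_cast
    ring
  have e4 : critVal φ (nextAmp φ a h) p = ∑ j, fderiv ℝ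
      (avg (crit φ) (fun h z => fderiv ℝ (a h) z (0, ev j)) h) ((p, p.2), x) ((0, ev j), 0) := by
    rw [critVal, hx]
    rfl
  rw [e4, mixedDiv_eq hq, laplX_eq hq, radialSq_eq hq, Finset.sum_congr rfl fun j _ => e3 j]
  simp only [Finset.sum_add_distrib, ← Finset.mul_sum]
  ring

end SecondOrder

/-! ### Reordering the iterated integrals -/

section Fubini

variable {d : ℕ}

theorem integrable_prod_of_bound {f : Eu d × Eu d → ℂ} {α β : Eu d → ℝ}
    (hf : AEStronglyMeasurable f (volume.prod volume)) (hα : Integrable α) (hβ : Integrable β)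
    (hb : ∀ z, ‖f z‖ ≤ α z.1 * β z.2) : Integrable f (volume.prod volume) :=
  (hα.mul_prod hβ).mono' hf (Filter.Eventually.of_forall hb)

/-- Moving the innermost of three integrations to the outermost place. -/
theorem integral_triple_swap {Θ : Eu d → Eu d → Eu d → ℂ} {α β γ δ : Eu d → ℝ}
    (hΘ : Continuous (fun q : Eu d × Eu d × Eu d => Θ q.1 q.2.1 q.2.2))
    (hα : Integrable α) (hβ : Integrable β) (hγ : Integrable γ) (hδ : Integrable δ)
    (hB : ∀ x, ∃ C : ℝ, ∀ η ξ, ‖Θ η ξ x‖ ≤ C * α η * β ξ)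
    (hD : ∀ η x, ‖∫ ξ, Θ η ξ x‖ ≤ α η * δ x)
    (hE : ∀ ξ x, ‖∫ η, Θ η ξ x‖ ≤ γ ξ * δ x) :
    Integrable (fun ξ => ∫ x, ∫ η, Θ η ξ x) ∧
      ∫ η, ∫ x, ∫ ξ, Θ η ξ x = ∫ ξ, ∫ x, ∫ η, Θ η ξ x := by
  have iD : Integrable (fun z : Eu d × Eu d => ∫ ξ, Θ z.1 ξ z.2) (volume.prod volume) := by
    refine integrable_prod_of_bound ?_ hα hδ fun z => hD z.1 z.2
    refine AEStronglyMeasurable.integral_prod_right' (f := fun q : (Eu d × Eu d) × Eu d =>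
      Θ q.1.1 q.2 q.1.2) (Continuous.aestronglyMeasurable ?_)
    exact hΘ.comp (f := fun q : (Eu d × Eu d) × Eu d => (q.1.1, q.2, q.1.2)) (by fun_prop)
  have iE : Integrable (fun z : Eu d × Eu d => ∫ η, Θ η z.1 z.2) (volume.prod volume) := by
    refine integrable_prod_of_bound ?_ hγ hδ fun z => hE z.1 z.2
    refine AEStronglyMeasurable.integral_prod_right' (f := fun q : (Eu d × Eu d) × Eu d =>
      Θ q.2 q.1.1 q.1.2) (Continuous.aestronglyMeasurable ?_)
    exact hΘ.comp (f := fun q : (Eu d × Eu d) × Eu d => (q.2, q.1.1, q.1.2)) (by fun_prop)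
  have iB : ∀ x, Integrable (fun z : Eu d × Eu d => Θ z.1 z.2 x) (volume.prod volume) := by
    intro x
    obtain ⟨C, hC⟩ := hB x
    refine integrable_prod_of_bound (Continuous.aestronglyMeasurable ?_) (hα.const_mul C) hβ
      fun z => hC z.1 z.2
    exact hΘ.comp (f := fun q : Eu d × Eu d => (q.1, q.2, x)) (by fun_prop)
  refine ⟨iE.integral_prod_left, ?_⟩
  -- No bound makes `Θ` jointly integrable: decay in `x` appears only once `ξ` or `η` has been
  -- integrated out. Each swap therefore concerns two variables, with the third integrated or, in
  -- the middle step where `x` plays this role, frozen.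
  calc ∫ η, ∫ x, ∫ ξ, Θ η ξ x = ∫ x, ∫ η, ∫ ξ, Θ η ξ x :=
        integral_integral_swap (f := fun η x => ∫ ξ, Θ η ξ x) iD
    _ = ∫ x, ∫ ξ, ∫ η, Θ η ξ x := by
        congr 1
        ext x
        exact integral_integral_swap (f := fun η ξ => Θ η ξ x) (iB x)
    _ = ∫ ξ, ∫ x, ∫ η, Θ η ξ x :=
        (integral_integral_swap (f := fun ξ x => ∫ η, Θ η ξ x) iE).symm

end Fubini

/-! ### Uniform decay of semiclassical Fourier integrals -/

section FourierDecay

variable {d : ℕ}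

open FourierTransform in
-- The constant depends on `f` only through `B`, with the size `M` kept separate. This allows `f`
-- itself to vary with the frequency `x`, as it does when the symbol is evaluated at `x`.
theorem fourier_decay {h : ℝ} (hh : 0 < h) (L : ℕ) (B : ℕ → ℝ) :
    ∃ C : ℝ, 0 ≤ C ∧ ∀ f : Eu d → ℂ, ContDiff ℝ ∞ f → ∀ M : ℝ, 0 ≤ M →
      (∀ n ξ, ‖iteratedFDeriv ℝ n f ξ‖ ≤ B n * M * ((1 + ‖ξ‖) ^ (d + 1))⁻¹) →
      ∀ x, (1 + ‖x‖) ^ L * ‖∫ ξ, osc h (-inner ℝ ξ x) * f ξ‖ ≤ C * M := by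
  set I := ∫ x : Eu d, ((1 + ‖x‖) ^ (d + 1))⁻¹ with hI
  have hI0 : 0 ≤ I := integral_nonneg fun x => by positivity
  have hπ := Real.pi_pos
  set A : ℕ → ℝ := fun n => 2 ^ n * ∑ j ∈ Finset.range (n + 1), |B j| * I with hA
  have hA0 : ∀ n, 0 ≤ A n := fun n => by positivity
  refine ⟨2 ^ L * (A 0 + (2 * Real.pi * h) ^ L * A L),
    mul_nonneg (by positivity) (add_nonneg (hA0 0) (mul_nonneg (by positivity) (hA0 L))),
    fun f sf M hM hf x => ?_⟩
  have hdom : ∀ n, Integrable (fun ξ : Eu d => B n * M * ((1 + ‖ξ‖) ^ (d + 1))⁻¹) := fun n =>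
    integrable_inv_one_add_norm_pow.const_mul _
  have hin : ∀ n, Integrable (fun ξ => ‖iteratedFDeriv ℝ n f ξ‖) := fun n =>
    (hdom n).mono' (sf.continuous_iteratedFDeriv (by exact_mod_cast le_top)).norm.aestronglyMeasurable
      (Filter.Eventually.of_forall fun ξ => by simpa using hf n ξ)
  have hle : ∀ n, ∫ ξ, ‖iteratedFDeriv ℝ n f ξ‖ ≤ |B n| * I * M := fun n => by
    calc ∫ ξ, ‖iteratedFDeriv ℝ n f ξ‖ ≤ ∫ ξ : Eu d, B n * M * ((1 + ‖ξ‖) ^ (d + 1))⁻¹ :=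
          integral_mono (hin n) (hdom n) (hf n)
      _ = B n * M * I := by rw [integral_const_mul]
      _ ≤ |B n| * M * I := by
          gcongr
          exact le_abs_self _
      _ = _ := by ring
  have hF : ∀ n (k : Eu d), ‖k‖ ^ n * ‖𝓕 f k‖ ≤ A n * M := by
    intro n k
    have h1 := Real.pow_mul_norm_iteratedFDeriv_fourier_le (f := f) (K := 0) (N := ⊤) sf
      (fun k n hk _ => by
        have hk0 : k = 0 := by simpa using hk
        subst hk0
        simpa using hin n) (k := 0) (n := n) (by simp) le_top k
    rw [norm_iteratedFDeriv_zero] at h1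
    refine h1.trans ?_
    simp only [pow_zero, one_mul, Nat.cast_zero, mul_zero, zero_add, Finset.range_one, hA]
    rw [mul_assoc, Finset.sum_mul, Finset.sum_product]
    simp only [Finset.sum_singleton, pow_zero, one_mul]
    gcongr with j
    exact hle j
  set k : Eu d := (2 * Real.pi * h)⁻¹ • x with hk
  have e1 : ∫ ξ, osc h (-inner ℝ ξ x) * f ξ = 𝓕 f k := by
    rw [Real.fourier_eq]
    congr 1
    ext ξ
    rw [Circle.smul_def, smul_eq_mul, Real.fourierChar_apply, osc]
    congr 2
    rw [hk, inner_smul_right]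
    have hc : (h : ℂ) ≠ 0 := by exact_mod_cast hh.ne'
    have hpc : (Real.pi : ℂ) ≠ 0 := by exact_mod_cast hπ.ne'
    push_cast
    field_simp
  rw [e1]
  have hx : ‖x‖ = 2 * Real.pi * h * ‖k‖ := by
    rw [hk, norm_smul, norm_inv, Real.norm_of_nonneg (by positivity)]
    field_simp
  have h2 : (1 + ‖x‖) ^ L ≤ 2 ^ L * (1 + ‖x‖ ^ L) := by
    rcases le_total ‖x‖ 1 with h1 | h1
    · calc (1 + ‖x‖) ^ L ≤ (2 : ℝ) ^ L := by gcongr; linarith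
        _ ≤ 2 ^ L * (1 + ‖x‖ ^ L) := by
          refine le_mul_of_one_le_right (by positivity) ?_
          have := pow_nonneg (norm_nonneg x) L
          linarith
    · calc (1 + ‖x‖) ^ L ≤ (2 * ‖x‖) ^ L := by gcongr; linarith
        _ = 2 ^ L * ‖x‖ ^ L := mul_pow _ _ _
        _ ≤ 2 ^ L * (1 + ‖x‖ ^ L) := by gcongr; linarith
  calc (1 + ‖x‖) ^ L * ‖𝓕 f k‖ ≤ 2 ^ L * (1 + ‖x‖ ^ L) * ‖𝓕 f k‖ := by gcongr
    _ = 2 ^ L * (‖k‖ ^ 0 * ‖𝓕 f k‖ + (2 * Real.pi * h) ^ L * (‖k‖ ^ L * ‖𝓕 f k‖)) := by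
        rw [hx]; ring
    _ ≤ 2 ^ L * (A 0 * M + (2 * Real.pi * h) ^ L * (A L * M)) := by
        have h3 := hF 0 k
        have h4 := hF L k
        gcongr
    _ = _ := by ring

end FourierDecay

/-! ### Symbols tested against Schwartz functions -/

section SchwartzSymbol

variable {d : ℕ} {q : Eu d × Eu d → ℂ} {κ : Set (Eu d)}

/-- Products of a Schwartz function of `ξ` and a symbol. -/
theorem exists_bound_schwartz_mul_symbol (hq : ContDiff ℝ ∞ q) {N : ℕ}
    (hN : ∀ k : ℕ, ∃ C : ℝ, ∀ z, ‖iteratedFDeriv ℝ k q z‖ ≤ C * (1 + ‖z‖) ^ N)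
    (hκ : IsCompact κ) (u : 𝓢(Eu d, ℂ)) (m k : ℕ) :
    ∃ C : ℝ, 0 ≤ C ∧ ∀ p : Eu d × Eu d, ∀ η ∈ κ, ∀ x,
      ‖iteratedFDeriv ℝ k (fun z : ((Eu d × Eu d) × Eu d) × Eu d =>
        u z.1.1.2 * q (midMap d z)) ((p, η), x)‖ ≤
        C * (1 + ‖x‖) ^ N * ((1 + ‖p.2‖) ^ m)⁻¹ := by
  set pr : ((Eu d × Eu d) × Eu d) × Eu d →L[ℝ] Eu d :=
    (ContinuousLinearMap.snd ℝ _ _).comp ((ContinuousLinearMap.fst ℝ _ _).comp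
      (ContinuousLinearMap.fst ℝ _ _)) with hpr
  have su : ContDiff ℝ ∞ u := u.smooth ⊤
  choose C hC using hN
  obtain ⟨R, hR⟩ := hκ.isBounded.exists_norm_le
  -- Of the `N + m` powers of decay of `u`, `N` compensate the growth of the symbol in `ξ` through
  -- the midpoint, and `m` remain.
  set A : ℕ → ℝ := fun i => 2 ^ (N + m) *
    ((Finset.Iic (N + m, i)).sup fun m => SchwartzMap.seminorm ℝ m.1 m.2) u with hA
  have hu : ∀ i ξ, (1 + ‖ξ‖) ^ (N + m) * ‖iteratedFDeriv ℝ i u ξ‖ ≤ A i := fun i ξ =>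
    SchwartzMap.one_add_le_sup_seminorm_apply (𝕜 := ℝ) (m := (N + m, i)) le_rfl le_rfl u ξ
  have hA0 : ∀ i, 0 ≤ A i := fun i => le_trans (by positivity) (hu i 0)
  refine ⟨∑ i ∈ Finset.range (k + 1), (k.choose i : ℝ) * (‖pr‖ ^ i * A i) *
    (‖midMap d‖ ^ (k - i) * (|C (k - i)| * (1 + |R|) ^ N)), Finset.sum_nonneg fun i _ => ?_,
    fun p η hη x => ?_⟩
  · have := hA0 i
    positivity
  refine (norm_iteratedFDeriv_mul_le (su.comp pr.contDiff) (hq.comp (midMap d).contDiff)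
    ((p, η), x) (n := k) (by exact_mod_cast le_top)).trans ?_
  rw [Finset.sum_mul, Finset.sum_mul]
  refine Finset.sum_le_sum fun i _ => ?_
  have b1 : ‖iteratedFDeriv ℝ i (fun z => u (pr z)) ((p, η), x)‖ ≤
      ‖pr‖ ^ i * (A i * ((1 + ‖p.2‖) ^ (N + m))⁻¹) := by
    refine (norm_iteratedFDeriv_comp_clm_le pr su i _).trans ?_
    gcongr
    rw [← div_eq_mul_inv, le_div_iff₀ (by positivity), mul_comm]
    exact hu i p.2
  have b2 : 1 + ‖midMap d ((p, η), x)‖ ≤ (1 + |R|) * ((1 + ‖p.2‖) * (1 + ‖x‖)) := by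
    have h1 : ‖midMap d ((p, η), x)‖ ≤ |R| + ‖p.2‖ + ‖x‖ := by
      rw [midMap_apply, Prod.norm_mk]
      refine max_le ?_ ?_
      · rw [norm_smul]
        have h2 := norm_add_le η p.2
        have h3 := (hR η hη).trans (le_abs_self R)
        norm_num
        nlinarith [norm_nonneg x, norm_nonneg (η + p.2)]
      · change ‖x‖ ≤ _
        linarith [abs_nonneg R, norm_nonneg p.2]
    have h4 := mul_nonneg (norm_nonneg p.2) (norm_nonneg x)
    have h5 := mul_nonneg (abs_nonneg R) (add_nonneg (add_nonneg (norm_nonneg p.2)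
      (norm_nonneg x)) h4)
    nlinarith
  have b3 : ‖iteratedFDeriv ℝ (k - i) (fun z => q (midMap d z)) ((p, η), x)‖ ≤
      ‖midMap d‖ ^ (k - i) * (|C (k - i)| * ((1 + |R|) * ((1 + ‖p.2‖) * (1 + ‖x‖))) ^ N) := by
    refine (norm_iteratedFDeriv_comp_clm_le (midMap d) hq (k - i) _).trans ?_
    gcongr
    refine (hC (k - i) _).trans ?_
    gcongr
    exact le_abs_self _
  have hA' := hA0 i
  have hne : (1 + ‖p.2‖) ^ N ≠ 0 := by positivity
  calc (k.choose i : ℝ) * ‖iteratedFDeriv ℝ i (fun z => u (pr z)) ((p, η), x)‖ *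
        ‖iteratedFDeriv ℝ (k - i) (fun z => q (midMap d z)) ((p, η), x)‖
      ≤ (k.choose i : ℝ) * (‖pr‖ ^ i * (A i * ((1 + ‖p.2‖) ^ (N + m))⁻¹)) *
        (‖midMap d‖ ^ (k - i) *
          (|C (k - i)| * ((1 + |R|) * ((1 + ‖p.2‖) * (1 + ‖x‖))) ^ N)) := by
        gcongr
    _ = _ := by
        rw [mul_pow, mul_pow, pow_add, mul_inv]
        field_simp

/-- The function `(1 + |ξ|²)^m u`. -/
theorem exists_schwartz_weight (u : 𝓢(Eu d, ℂ)) (m : ℕ) :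
    ∃ v : 𝓢(Eu d, ℂ), ∀ ξ, v ξ = (((1 + ‖ξ‖ ^ 2) ^ m : ℝ) : ℂ) * u ξ := by
  have hg : Function.HasTemperateGrowth (fun x : Eu d => (1 + ‖x‖ ^ 2) ^ m) := by fun_prop
  refine ⟨SchwartzMap.smulLeftCLM ℂ (fun x : Eu d => (1 + ‖x‖ ^ 2) ^ m) u, fun ξ => ?_⟩
  rw [SchwartzMap.smulLeftCLM_apply_apply hg, Complex.real_smul]

end SchwartzSymbol

/-! ### Bounds for the two partial integrals -/

section Kernel

variable {d : ℕ} {φ : Eu d × Eu d → ℝ} {χ : Eu d → ℝ} {q : Eu d × Eu d → ℂ} {h : ℝ}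

/-- The amplitude `χ(η) q((η + ξ) / 2, x)` of the kernel. -/
def cutAmp (χ : Eu d → ℝ) (q : Eu d × Eu d → ℂ) (z : ((Eu d × Eu d) × Eu d) × Eu d) : ℂ :=
  (χ z.1.2 : ℂ) * q (midMap d z)

theorem etaSupp_cutAmp (χ : Eu d → ℝ) (q : Eu d × Eu d → ℂ) :
    EtaSupp (tsupport χ) (cutAmp χ q) := fun p η x hη => by
  simp [cutAmp, image_eq_zero_of_notMem_tsupport hη]

theorem isAmplitude_cutAmp (hχ : ContDiff ℝ ∞ χ) {h₀ : ℝ} {r : ℝ → Eu d × Eu d → ℂ}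
    (hr : IsBoundedSymbolFamily h₀ r) :
    IsAmplitude h₀ (tsupport χ) (fun h => cutAmp χ (r h)) :=
  ⟨(IsTempered.base (m := fun w : (Eu d × Eu d) × Eu d => (χ w.2 : ℂ))
    (Complex.ofRealCLM.contDiff.comp (hχ.comp contDiff_snd))).mul (IsTempered.symbol hr (midMap d)),
    fun h _ => etaSupp_cutAmp χ (r h)⟩

theorem IsSymbol.isBoundedSymbolFamily (hq : IsSymbol q) (h₀ : ℝ) :
    IsBoundedSymbolFamily h₀ (fun _ => q) := by
  obtain ⟨sq, N, hN⟩ := hq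
  exact ⟨fun _ _ => sq, N, fun k => (hN k).imp fun C hC _ _ z => hC z⟩

/-- Integrability in `(ξ, x)` of the partial integral over `η`, tested against `u`. -/
theorem exists_bound_etaInt_mul (hφ : ContDiff ℝ ∞ φ) (hχ : ContDiff ℝ ∞ χ)
    (hχc : HasCompactSupport χ) (hq : IsSymbol q) (hh : 0 < h) (u : 𝓢(Eu d, ℂ)) (y : Eu d) :
    ∃ C : ℝ, 0 ≤ C ∧ ∀ ξ x, ‖etaInt φ h (cutAmp χ q) (y, ξ) x * u ξ‖ ≤
      C * ((1 + ‖ξ‖) ^ (d + 1))⁻¹ * ((1 + ‖x‖) ^ (d + 1))⁻¹ := by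
  obtain ⟨v, hv⟩ := exists_schwartz_weight u (d + 1)
  obtain ⟨sq, N, hN⟩ := hq
  have hκ : IsCompact (tsupport χ) := hχc
  set r : ((Eu d × Eu d) × Eu d) × Eu d → ℂ := fun z => v z.1.1.2 * q (midMap d z) with hr
  have sr : SmoothFam h (fun _ => r) := fun _ _ =>
    ((v.smooth ⊤).comp (contDiff_snd.comp (contDiff_fst.comp contDiff_fst))).mul
      (sq.comp (midMap d).contDiff)
  -- The bound must hold for all `ξ`. The decay of `v`, which carries the weight `(1 + ‖ξ‖²)^(d+1)`,
  -- makes the amplitude tempered uniformly on this unbounded set, and dividing by the weight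
  -- afterwards gives integrability in `ξ`.
  set S : Set (Eu d × Eu d) := {y} ×ˢ univ with hS
  have tr : TempOn h (S ×ˢ tsupport χ) N (fun _ => r) := by
    intro k
    obtain ⟨C, hC0, hC⟩ := exists_bound_schwartz_mul_symbol sq hN hκ v 0 k
    refine ⟨C, fun _ _ w hw x => ?_⟩
    simpa using hC w.1 w.2 hw.2 x
  have sc : ContDiff ℝ ∞ (fun η => (χ η : ℂ)) := Complex.ofRealCLM.contDiff.comp hχ
  have scf : SmoothFam h (fun _ (z : ((Eu d × Eu d) × Eu d) × Eu d) => (χ z.1.2 : ℂ)) :=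
    fun _ _ => sc.comp (contDiff_snd.comp contDiff_fst)
  have tc : TempOn h (S ×ˢ tsupport χ) 0
      (fun _ (z : ((Eu d × Eu d) × Eu d) × Eu d) => (χ z.1.2 : ℂ)) :=
    TempOn.base sc (ContinuousLinearMap.snd ℝ (Eu d × Eu d) (Eu d)) hκ fun w hw => hw.2
  obtain ⟨C, hC0, hC⟩ := etaInt_decay' hφ hκ (isCompact_singleton (x := y))
    (S := S) (fun p hp => hp.1) (scf.mul sr)
    (fun _ _ p η x hη => by
      simp [image_eq_zero_of_notMem_tsupport hη]) (tc.mul tr scf sr)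
  refine ⟨C * 2 ^ (d + 1), by positivity, fun ξ x => ?_⟩
  have h1 := hC h ⟨hh, le_rfl⟩ (y, ξ) ⟨rfl, mem_univ _⟩ x
  have e1 : etaInt φ h (fun z => (χ z.1.2 : ℂ) * r z) (y, ξ) x =
      (((1 + ‖ξ‖ ^ 2) ^ (d + 1) : ℝ) : ℂ) * (etaInt φ h (cutAmp χ q) (y, ξ) x * u ξ) := by
    rw [mul_comm (etaInt _ _ _ _ _), ← mul_assoc, ← hv]
    unfold etaInt
    rw [← integral_const_mul]
    congr 1
    ext η
    simp only [hr, cutAmp]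
    ring
  rw [e1, norm_mul, Complex.norm_real, Real.norm_of_nonneg (by positivity)] at h1
  have h2 : (1 + ‖ξ‖) ^ (d + 1) ≤ 2 ^ (d + 1) * (1 + ‖ξ‖ ^ 2) ^ (d + 1) := by
    rw [← mul_pow]
    gcongr
    nlinarith [sq_nonneg (‖ξ‖ - 1), norm_nonneg ξ]
  set X := ‖etaInt φ h (cutAmp χ q) (y, ξ) x * u ξ‖ with hX
  have hX0 : 0 ≤ X := norm_nonneg _
  have h3 : 0 < (1 + ‖ξ‖) ^ (d + 1) := by positivity
  calc X = (1 + ‖ξ‖) ^ (d + 1) * X * ((1 + ‖ξ‖) ^ (d + 1))⁻¹ := by field_simp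
    _ ≤ 2 ^ (d + 1) * (1 + ‖ξ‖ ^ 2) ^ (d + 1) * X * ((1 + ‖ξ‖) ^ (d + 1))⁻¹ := by gcongr
    _ = 2 ^ (d + 1) * ((1 + ‖ξ‖ ^ 2) ^ (d + 1) * X) * ((1 + ‖ξ‖) ^ (d + 1))⁻¹ := by ring
    _ ≤ 2 ^ (d + 1) * (C * ((1 + ‖x‖) ^ (d + 1))⁻¹) * ((1 + ‖ξ‖) ^ (d + 1))⁻¹ := by gcongr
    _ = _ := by ring

/-- Up to a unimodular factor this is a Fourier integral in `ξ` at a frequency proportional to `x`.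
`fourier_decay` applies with `M = (1 + ‖x‖) ^ N` and `N + (d + 1)` powers, the first `N` of which
cancel `M`. -/
theorem exists_bound_integral_schwartz_symbol {κ : Set (Eu d)} (hκ : IsCompact κ)
    (hq : IsSymbol q) (hh : 0 < h) (u : 𝓢(Eu d, ℂ)) :
    ∃ C : ℝ, 0 ≤ C ∧ ∀ η ∈ κ, ∀ x,
      ‖∫ ξ, osc h (inner ℝ (η - ξ) x) * q ((2⁻¹ : ℝ) • (η + ξ), x) * u ξ‖ ≤
        C * ((1 + ‖x‖) ^ (d + 1))⁻¹ := by
  obtain ⟨sq, N, hN⟩ := hq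
  set r : ((Eu d × Eu d) × Eu d) × Eu d → ℂ := fun z => u z.1.1.2 * q (midMap d z) with hr
  have sr : ContDiff ℝ ∞ r :=
    ((u.smooth ⊤).comp (contDiff_snd.comp (contDiff_fst.comp contDiff_fst))).mul
      (sq.comp (midMap d).contDiff)
  set ι : Eu d →L[ℝ] ((Eu d × Eu d) × Eu d) × Eu d := (ContinuousLinearMap.inl ℝ _ _).comp
    ((ContinuousLinearMap.inl ℝ _ _).comp (ContinuousLinearMap.inr ℝ _ _)) with hι
  choose B hB0 hB using exists_bound_schwartz_mul_symbol sq hN hκ u (d + 1)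
  obtain ⟨C, hC0, hC⟩ := fourier_decay (d := d) hh (N + (d + 1)) (fun n => ‖ι‖ ^ n * B n)
  refine ⟨C, hC0, fun η hη x => ?_⟩
  set z₀ : ((Eu d × Eu d) × Eu d) × Eu d := ((0, η), x) with hz₀
  have hz : ∀ ξ, z₀ + ι ξ = (((0, ξ), η), x) := fun ξ => by simp [hz₀, hι]
  have srz : ContDiff ℝ ∞ (fun z => r (z₀ + z)) := sr.comp (contDiff_const.add contDiff_id)
  have h1 := hC (fun ξ => r (z₀ + ι ξ)) (srz.comp ι.contDiff) ((1 + ‖x‖) ^ N) (by positivity)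
    (fun n ξ => by
      refine (norm_iteratedFDeriv_comp_clm_le ι srz n ξ).trans ?_
      rw [iteratedFDeriv_comp_add_left, hz, mul_assoc, mul_assoc]
      gcongr
      simpa [mul_assoc] using hB n (0, ξ) η hη x) x
  have e1 : ∫ ξ, osc h (inner ℝ (η - ξ) x) * q ((2⁻¹ : ℝ) • (η + ξ), x) * u ξ =
      osc h (inner ℝ η x) * ∫ ξ, osc h (-inner ℝ ξ x) * r (z₀ + ι ξ) := by
    rw [← integral_const_mul]
    congr 1
    ext ξ
    rw [hz, inner_sub_left, sub_eq_add_neg, osc_add]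
    simp only [hr, midMap_apply]
    ring
  rw [e1, norm_mul, norm_osc, one_mul]
  have h2 : 0 < (1 + ‖x‖) ^ N := by positivity
  have h3 : 0 < (1 + ‖x‖) ^ (d + 1) := by positivity
  rw [pow_add, mul_assoc, mul_comm C, mul_le_mul_iff_right₀ h2] at h1
  rw [← div_eq_mul_inv, le_div_iff₀ h3]
  linarith

end Kernel

/-! ### The Schwartz kernel as an oscillatory integral -/

section SchwartzKernel

variable {d : ℕ} {φ : Eu d × Eu d → ℝ} {χ : Eu d → ℝ} {q q' : Eu d × Eu d → ℂ} {h : ℝ}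

/-- The operator integrates in the order `ξ`, `x`, `η`, the kernel in the order `η`, `x`, `ξ`.
`integral_triple_swap` identifies the two; its bounds come from the Schwartz decay in `ξ`, the
cut-off in `η`, and the two partial integrals. -/
theorem isSchwartzKernel_cutV_weylOp (G : GLd d) (hφ : ContDiff ℝ ∞ φ) (hχ : ContDiff ℝ ∞ χ)
    (hχc : HasCompactSupport χ) (hφG : ∀ y, ∀ η ∈ tsupport χ, φ (y, η) = phase G y η)
    (hq : IsSymbol q) (hh : 0 < h) :
    IsSchwartzKernel (fun u => cutV G χ h (weylOp h q u))
      (fun y ξ => osc h (φ (y, ξ)) * oscInt φ h (cutAmp χ q) (y, ξ)) := by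
  have hκ : IsCompact (tsupport χ) := hχc
  have ha := isAmplitude_cutAmp hχ (hq.isBoundedSymbolFamily h)
  refine ⟨?_, fun u y => ?_⟩
  · exact ((contDiff_osc h).continuous.comp hφ.continuous).mul
      (ha.contDiff_oscInt hφ hκ ⟨hh, le_rfl⟩).continuous
  obtain ⟨CE, hCE0, hCE⟩ := exists_bound_etaInt_mul hφ hχ hχc hq hh u y
  obtain ⟨CD, hCD0, hCD⟩ := exists_bound_integral_schwartz_symbol hκ hq hh u
  obtain ⟨sq, N, hN⟩ := hq
  obtain ⟨CB, hCB0, hCB⟩ := exists_bound_schwartz_mul_symbol sq hN hκ u (d + 1) 0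
  obtain ⟨X, hX⟩ := hχc.exists_bound_of_continuous hχ.continuous
  have hX0 : 0 ≤ X := (norm_nonneg _).trans (hX 0)
  set Θ : Eu d → Eu d → Eu d → ℂ := fun η ξ x => osc h (φ (y, η)) * (χ η : ℂ) *
    (osc h (inner ℝ (η - ξ) x) * q ((2⁻¹ : ℝ) • (η + ξ), x) * u ξ) with hΘ
  have cΘ : Continuous (fun p : Eu d × Eu d × Eu d => Θ p.1 p.2.1 p.2.2) := by
    have h1 := (contDiff_osc h).continuous
    have h2 := hφ.continuous
    have h3 := hχ.continuous
    have h4 := sq.continuous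
    have h5 := u.continuous
    simp only [hΘ]
    fun_prop
  have hΘ0 : ∀ η ∉ tsupport χ, ∀ ξ x, Θ η ξ x = 0 := fun η hη ξ x => by
    simp [hΘ, image_eq_zero_of_notMem_tsupport hη]
  have hcχ : ∀ η, ‖osc h (φ (y, η)) * (χ η : ℂ)‖ ≤ X := fun η => by
    rw [norm_mul, norm_osc, one_mul, Complex.norm_real]
    exact hX η
  -- One function `α` serves two bounds of `integral_triple_swap`: `A ≥ X * CD` controls the
  -- integral over `ξ`, and `A ≥ 1` the pointwise bound.
  set A := X * CD + 1 with hA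
  have hA1 : 1 ≤ A := le_add_of_nonneg_left (by positivity)
  have hE : ∀ ξ x, ∫ η, Θ η ξ x =
      osc h (φ (y, ξ)) * (etaInt φ h (cutAmp χ q) (y, ξ) x * u ξ) := by
    intro ξ x
    rw [etaInt, ← integral_mul_const, ← integral_const_mul]
    congr 1
    ext η
    have e1 : relPhase φ (((y, ξ), η), x) = (φ (y, η) + inner ℝ (η - ξ) x) - φ (y, ξ) := by
      simp only [relPhase]; ring
    have e2 : osc h (φ (y, η)) * osc h (inner ℝ (η - ξ) x) =
        osc h (φ (y, ξ)) * osc h (relPhase φ (((y, ξ), η), x)) := by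
      rw [← osc_add, ← osc_add, e1]
      congr 1
      ring
    simp only [hΘ, cutAmp, midMap_apply]
    linear_combination ((χ η : ℂ) * q ((2⁻¹ : ℝ) • (η + ξ), x) * u ξ) * e2
  obtain ⟨hint, hswap⟩ := integral_triple_swap (Θ := Θ)
    (α := (tsupport χ).indicator fun _ => A) (β := fun ξ => ((1 + ‖ξ‖) ^ (d + 1))⁻¹)
    (γ := fun ξ => CE * ((1 + ‖ξ‖) ^ (d + 1))⁻¹) (δ := fun x => ((1 + ‖x‖) ^ (d + 1))⁻¹) cΘ
    ((integrable_indicator_iff hκ.measurableSet).2 (continuousOn_const.integrableOn_compact hκ))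
    integrable_inv_one_add_norm_pow
    (integrable_inv_one_add_norm_pow.const_mul _) integrable_inv_one_add_norm_pow
    (fun x => ⟨X * (CB * (1 + ‖x‖) ^ N), fun η ξ => by
      by_cases hη : η ∈ tsupport χ
      · rw [indicator_of_mem hη]
        have h1 := hCB (y, ξ) η hη x
        rw [norm_iteratedFDeriv_zero, midMap_apply] at h1
        have h2 : ‖osc h (inner ℝ (η - ξ) x) * q ((2⁻¹ : ℝ) • (η + ξ), x) * u ξ‖ ≤
            CB * (1 + ‖x‖) ^ N * ((1 + ‖ξ‖) ^ (d + 1))⁻¹ := by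
          rw [norm_mul, norm_mul, norm_osc, one_mul, mul_comm, ← norm_mul]
          exact h1
        calc ‖Θ η ξ x‖ ≤ X * (CB * (1 + ‖x‖) ^ N * ((1 + ‖ξ‖) ^ (d + 1))⁻¹) := by
              simp only [hΘ]
              rw [norm_mul]
              exact mul_le_mul (hcχ η) h2 (norm_nonneg _) hX0
          _ = X * (CB * (1 + ‖x‖) ^ N) * 1 * ((1 + ‖ξ‖) ^ (d + 1))⁻¹ := by ring
          _ ≤ X * (CB * (1 + ‖x‖) ^ N) * A * ((1 + ‖ξ‖) ^ (d + 1))⁻¹ := by gcongr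
      · rw [indicator_of_notMem hη, hΘ0 η hη]
        simp⟩)
    (fun η x => by
      by_cases hη : η ∈ tsupport χ
      · rw [indicator_of_mem hη]
        simp only [hΘ]
        rw [integral_const_mul, norm_mul]
        calc _ ≤ X * (CD * ((1 + ‖x‖) ^ (d + 1))⁻¹) :=
              mul_le_mul (hcχ η) (hCD η hη x) (norm_nonneg _) hX0
          _ = X * CD * ((1 + ‖x‖) ^ (d + 1))⁻¹ := by ring
          _ ≤ A * ((1 + ‖x‖) ^ (d + 1))⁻¹ := by
              gcongr
              linarith
      · rw [indicator_of_notMem hη]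
        simp [hΘ0 η hη])
    (fun ξ x => by
      rw [hE, norm_mul, norm_osc, one_mul]
      exact hCE ξ x)
  have hK : ∀ ξ, osc h (φ (y, ξ)) * oscInt φ h (cutAmp χ q) (y, ξ) * u ξ =
      (((2 * Real.pi * h) ^ d)⁻¹ : ℝ) * ∫ x, ∫ η, Θ η ξ x := by
    intro ξ
    simp_rw [hE]
    rw [integral_const_mul, integral_mul_const, oscInt]
    ring
  have hV : ∀ η, osc h (phase G y η) * (χ η : ℂ) * weylOp h q (fun ξ => u ξ) η =
      ∫ x, ∫ ξ, Θ η ξ x := by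
    intro η
    by_cases hη : η ∈ tsupport χ
    · rw [← hφG y η hη, weylOp, ← integral_const_mul]
      simp_rw [hΘ, integral_const_mul]
    · simp [hΘ0 η hη, image_eq_zero_of_notMem_tsupport hη]
  constructor
  · simp_rw [hK]
    exact hint.const_mul _
  · simp_rw [hK, cutV, hV]
    rw [integral_const_mul, hswap]

theorem IsSymbol.add (hq : IsSymbol q) (hq' : IsSymbol q') : IsSymbol (fun z => q z + q' z) := by
  obtain ⟨sq, N, hN⟩ := hq
  obtain ⟨sq', M, hM⟩ := hq'
  refine ⟨sq.add sq', max N M, fun k => ?_⟩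
  obtain ⟨C, hC⟩ := hN k
  obtain ⟨D, hD⟩ := hM k
  refine ⟨|C| + |D|, fun z => ?_⟩
  change ‖iteratedFDeriv ℝ k (q + q') z‖ ≤ _
  rw [iteratedFDeriv_add_apply (sq.of_le (by exact_mod_cast le_top)).contDiffAt
    (sq'.of_le (by exact_mod_cast le_top)).contDiffAt, add_mul]
  refine (norm_add_le _ _).trans (add_le_add ((hC z).trans ?_) ((hD z).trans ?_))
  · gcongr
    · exact le_abs_self C
    · exact one_le_one_add_norm z
    · exact le_max_left _ _
  · gcongr
    · exact le_abs_self D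
    · exact one_le_one_add_norm z
    · exact le_max_right _ _

theorem IsSymbol.const_mul (hq : IsSymbol q) (c : ℂ) : IsSymbol (fun z => c * q z) := by
  obtain ⟨sq, N, hN⟩ := hq
  refine ⟨contDiff_const.mul sq, N, fun k => ?_⟩
  obtain ⟨C, hC⟩ := hN k
  refine ⟨‖c‖ * C, fun z => ?_⟩
  change ‖iteratedFDeriv ℝ k (c • q) z‖ ≤ _
  rw [iteratedFDeriv_const_smul_apply (sq.of_le (by exact_mod_cast le_top)).contDiffAt, norm_smul,
    mul_assoc]
  gcongr
  exact hC z

theorem IsBoundedSymbolFamily.isSymbol {h₀ : ℝ} {r : ℝ → Eu d × Eu d → ℂ}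
    (hr : IsBoundedSymbolFamily h₀ r) (hh : h ∈ Ioc 0 h₀) : IsSymbol (r h) := by
  obtain ⟨sr, N, hN⟩ := hr
  exact ⟨sr h hh, N, fun k => (hN k).imp fun C hC z => hC h hh z⟩

end SchwartzKernel

/-! ### The remainder in the `C^∞` topology -/

section Remainder

variable {d : ℕ} {φ : Eu d × Eu d → ℝ} {κ : Set (Eu d)} {h₀ : ℝ}
  {a : ℝ → ((Eu d × Eu d) × Eu d) × Eu d → ℂ}

theorem IsAmplitude.isSmoothBigO (ha : IsAmplitude h₀ κ a) (hφ : ContDiff ℝ ∞ φ)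
    (hκ : IsCompact κ) (m : ℕ) (U : Set (Eu d × Eu d)) :
    IsSmoothBigO h₀ m U (fun h p => (h : ℂ) ^ m * oscInt φ h (a h) p) := by
  refine ⟨fun h hh => (contDiff_const.mul (ha.contDiff_oscInt hφ hκ hh)).contDiffOn,
    fun S _ hS k => ?_⟩
  obtain ⟨C, -, hC⟩ := ha.iteratedFDeriv_oscInt_bound hφ hκ hS k
  refine ⟨C, fun h hh p hp => ?_⟩
  change ‖iteratedFDeriv ℝ k ((h : ℂ) ^ m • oscInt φ h (a h)) p‖ ≤ _
  rw [iteratedFDeriv_const_smul_apply ((ha.contDiff_oscInt hφ hκ hh).of_le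
    (by exact_mod_cast le_top)).contDiffAt, norm_smul, norm_pow, Complex.norm_real,
    Real.norm_of_nonneg hh.1.le, mul_comm]
  have := pow_nonneg hh.1.le m
  gcongr
  exact hC h hh p hp

end Remainder

end

end TiltedFIO

/-! ### Assembly of the expansion -/

theorem mainTheorem5 (d : ℕ) (G : GLd d)
    (χ : Eu d → ℝ) (hχ : ContDiff ℝ ∞ χ) (hχc : HasCompactSupport χ)
    (hχs : tsupport χ ⊆ Metric.ball 0 1)
    (h₀ : ℝ) (hh₀ : 0 < h₀)
    (q : ℝ → Eu d × Eu d → ℂ) (q₀ q₁ : Eu d × Eu d → ℂ)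
    (hq : HasSymbolExpansion h₀ q q₀ q₁) :
    ∃ K : ℝ → Eu d → Eu d → ℂ,
      (∀ h ∈ Set.Ioc 0 h₀, IsSchwartzKernel (fun u => cutV G χ h (weylOp h (q h) u)) (K h)) ∧
      ∃ ρ : ℝ → Eu d × Eu d → ℂ,
        IsSmoothBigO h₀ 2 (Set.univ ×ˢ interior {ξ | χ ξ = 1}) ρ ∧
        ∀ h ∈ Set.Ioc 0 h₀, ∀ y : Eu d, ∀ ξ ∈ interior {ξ | χ ξ = 1},
          K h y ξ = osc h (phase G y ξ) *
            (q₀ (ξ, xTilde G y ξ) + (h : ℂ) * q₁ (ξ, xTilde G y ξ)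
              + (Complex.I * (h : ℂ) / 2) *
                (mixedDiv q₀ ξ (xTilde G y ξ)
                  + (alpha G y : ℂ) * laplX q₀ ξ (xTilde G y ξ) / (fHeight ξ : ℂ)
                  + (alpha G y : ℂ) / (fHeight ξ : ℂ) ^ 3 * radialSq q₀ ξ (xTilde G y ξ))
              + ρ h (y, ξ)) := by
  obtain ⟨hq₀, hq₁, r, hr, hqr⟩ := hq
  have hκ : IsCompact (tsupport χ) := hχc
  obtain ⟨φ, hφ, U, -, hκU, -, hφU, hcU, hdU⟩ := exists_smooth_phase G hκ hχs
  have a₀ := isAmplitude_cutAmp hχ (hq₀.isBoundedSymbolFamily h₀)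
  have a₁ := isAmplitude_cutAmp hχ (hq₁.isBoundedSymbolFamily h₀)
  have ar := isAmplitude_cutAmp hχ hr
  have n₀ := a₀.nextAmp hφ hκ
  -- The three contributions of order `h²`: `(ih)² = -h²` from two expansions of `q₀`, `ih · h` from
  -- one expansion of `q₁`, and `r` itself.
  have nn₀ := (n₀.nextAmp hφ hκ).const_mul (c := fun _ => (-1 : ℂ)) (R := 1) (by simp)
  have n₁ := (a₁.nextAmp hφ hκ).const_mul (c := fun _ => Complex.I) (R := 1) (by simp)
  have hb := nn₀.add (n₁.add ar)
  refine ⟨fun h y ξ => osc h (φ (y, ξ)) * oscInt φ h (cutAmp χ (q h)) (y, ξ), fun h hh => ?_,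
    _, hb.isSmoothBigO hφ hκ 2 _, fun h hh y ξ hξ => ?_⟩
  · refine isSchwartzKernel_cutV_weylOp G hφ hχ hχc (fun y η hη => hφU y η (hκU hη)) ?_ hh.1
    rw [funext (hqr h hh)]
    exact (hq₀.add (hq₁.const_mul _)).add ((hr.isSymbol hh).const_mul _)
  · have hχ1 : χ ξ = 1 := (interior_subset : interior {ξ | χ ξ = 1} ⊆ {ξ | χ ξ = 1}) hξ
    have hξU : ξ ∈ U := hκU (subset_tsupport χ (by simp [hχ1]))
    have hbd : ∀ h ∈ Ioc 0 h₀, ‖(h : ℂ)‖ ≤ h₀ := fun h hh => by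
      rw [Complex.norm_real, Real.norm_of_nonneg hh.1.le]
      exact hh.2
    have hbd2 : ∀ h ∈ Ioc 0 h₀, ‖(h : ℂ) ^ 2‖ ≤ h₀ ^ 2 := fun h hh => by
      rw [norm_pow]
      exact pow_le_pow_left₀ (norm_nonneg _) (hbd h hh) 2
    have b₁ := a₁.const_mul hbd
    have br := ar.const_mul hbd2
    have hsplit : cutAmp χ (q h) = fun z => cutAmp χ q₀ z +
        ((h : ℂ) * cutAmp χ q₁ z + (h : ℂ) ^ 2 * cutAmp χ (r h) z) := by
      ext z
      simp only [cutAmp, hqr h hh]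
      ring
    have hc : ∀ q : Eu d × Eu d → ℂ, critVal φ (cutAmp χ q) (y, ξ) = q (ξ, xTilde G y ξ) := by
      intro q
      have h1 : (2⁻¹ : ℝ) • (ξ + ξ) = ξ := by
        rw [← two_smul ℝ, smul_smul]
        norm_num
      rw [critVal, cutAmp, midMap_apply]
      simp only [hcU (y, ξ) ξ hξU, hχ1, h1]
      simp
    have hn := critVal_nextAmp hφ hχ hq₀.1 (p := (y, ξ)) hξ (hcU (y, ξ) ξ hξU)
      (hdU (y, ξ) ξ hξU) h
    change critVal φ (nextAmp φ (fun _ => cutAmp χ q₀) h) (y, ξ) = _ at hn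
    beta_reduce
    rw [hsplit, a₀.oscInt_add (b₁.add br) hφ hκ hh, b₁.oscInt_add br hφ hκ hh,
      oscInt_const_mul, oscInt_const_mul, a₀.oscInt_eq hφ hκ hh, n₀.oscInt_eq hφ hκ hh,
      a₁.oscInt_eq hφ hκ hh, nn₀.oscInt_add (n₁.add ar) hφ hκ hh, n₁.oscInt_add ar hφ hκ hh,
      oscInt_const_mul, oscInt_const_mul, hc, hc, hn, hφU y ξ hξU]
    -- All terms match except that the second expansion of `q₀` carries `I ^ 2` where the remainder
    -- has `-1`.
    linear_combination (osc h (phase G y ξ) * (h : ℂ) ^ 2 *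
      oscInt φ h (nextAmp φ (nextAmp φ (fun _ => cutAmp χ q₀)) h) (y, ξ)) * Complex.I_sq
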